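/- Let $K$ be an algebraically closed field of characteristic $p$, where $p$ is a prime with $p \neq 2, 3$, and let $E : y^2 = x^3 + Ax + B$ be an ordinary elliptic curve over $K$. Let $K[\varepsilon] = K[X]/(X^2)$ be the ring of dual numbers, and let $\tilde E = \tilde E(K[\varepsilon])$ be the group of points over $K[\varepsilon]$ of the curve with the same equation, that is, of the affine points $(x : y : 1)$ with $x, y \in K[\varepsilon]$ and $y^2 = x^3 + Ax + B$, and of the points at infinity $\mathcal O_k = (k\varepsilon : 1 : 0)$, $k \in K$, under the chord and tangent addition law. Let $\mathcal O = \mathcal O_0$ be the neutral element, and let $\Theta = \{\mathcal O_k : k \in K\}$. Fix a point $R \in E[p]$ with $R \notin E[2]$, a point $T \in E(K)$ of order two, and an addition chain decomposition $C$ of $p$: for some set $S \subseteq \{1, \dots, p\}$ with $p \in S$ in which every $k > 1$ is a sum of two elements of $S$, a sequence of steps, each replacing a summand $i + j$ by the two summands $i, j$ with $i, j, i + j \in S$, that turns $p$ into a sum of $p$ ones. For $P \in E[p]$ with $P \neq \mathcal O$ let $\ell_{i,j}$ be the (normalized) equation of the line through $iP$ and $jP$ (the tangent if $iP = jP$), $v_i$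 that of the vertical line through $iP$, and $\tau$ the translation by $-T$; put $h_{i,j} = (\ell_{i,j}/v_{i+j}) \circ \tau$ if $i + j \neq p$ and $h_{i,j} = v_i \circ \tau$ if $i + j = p$. Define $$e(P, \mathcal O_k) = \prod_{(i + j \mapsto i, j) \in C} \frac{h_{i,j}(\mathcal O_k + R)}{h_{i,j}(R)} \quad \text{if } P \neq \mathcal O \text{ and } k \neq 0, \qquad e(P, \mathcal O_k) = 1 \quad \text{otherwise.}$$ Then $\tilde E[p] = E[p] \oplus \Theta$, and there is exactly one map $e_p : \tilde E[p] \times \tilde E[p] \to \mu_p(K[\varepsilon])$ that is bilinear and antisymmetric ($e_p(P, Q) = e_p(Q, P)^{-1}$), is trivial on $E[p] \times E[p]$ and on $\Theta \times \Theta$, and equals $e$ on $E[p] \times \Theta$. This map $e_p$ is non-degenerate: if $e_p(P, Q) = 1$ for all $P \in \tilde E[p]$, then $Q = \mathcal O$, and if $e_p(P, Q) = 1$ for all $Q \in \tilde E[p]$, then $P = \mathcal O$. -/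

import Mathlib

open scoped DualNumber

namespace DualCurve

variable {K : Type*} [Field K]

/-- The canonical lift of `E` to the dual numbers: the same Weierstrass equation, read in `K[ε]`. -/
abbrev canonicalLift (E : WeierstrassCurve K) : WeierstrassCurve K[ε] :=
  E.map (TrivSqZeroExt.inlHom K K)

/-- The points over `K[ε]` of the canonical lift of `E`: the affine points `(x : y : 1)` with
`x, y ∈ K[ε]` satisfying the Weierstrass equation, and the points at infinity
`𝒪ₖ = (kε : 1 : 0)` with `k ∈ K`. -/
inductive DualPoint (E : WeierstrassCurve K)
  | affine (x y : K[ε]) (h : (canonicalLift E).toAffine.Equation x y)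
  | inf (k : K)

variable {E : WeierstrassCurve K}

theorem equation_iff [E.IsShortNF] (x y : K[ε]) :
    (canonicalLift E).toAffine.Equation x y ↔
      y ^ 2 = x ^ 3 + TrivSqZeroExt.inl E.a₄ * x + TrivSqZeroExt.inl E.a₆ := by
  rw [WeierstrassCurve.Affine.equation_iff]
  simp

/-- `kε`. -/
abbrev kEps (k : K) : K[ε] := TrivSqZeroExt.inr k

theorem kEps_mul_kEps (j k : K) : kEps j * kEps k = 0 :=
  TrivSqZeroExt.inr_mul_inr _ _ _

theorem dual_mul_inv {x : K[ε]} (hx : x.fst ≠ 0) : x * x⁻¹ = 1 :=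
  TrivSqZeroExt.mul_inv_cancel hx

/-- The value at `(x₁, x₂)` of `(f(x₁) - f(x₂)) / (x₁ - x₂)`, where `f = X³ + AX + B`. -/
def cubicQuot (E : WeierstrassCurve K) (x₁ x₂ : K[ε]) : K[ε] :=
  x₁ ^ 2 + x₁ * x₂ + x₂ ^ 2 + TrivSqZeroExt.inl E.a₄

theorem sub_mul_cubicQuot [E.IsShortNF] {x₁ y₁ x₂ y₂ : K[ε]}
    (h₁ : (canonicalLift E).toAffine.Equation x₁ y₁)
    (h₂ : (canonicalLift E).toAffine.Equation x₂ y₂) :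
    (x₁ - x₂) * cubicQuot E x₁ x₂ = (y₁ - y₂) * (y₁ + y₂) := by
  rw [equation_iff] at h₁ h₂
  rw [cubicQuot]
  linear_combination h₂ - h₁

/-- The slope of the line through two affine points whose sum is affine. As
`(y₁ - y₂)(y₁ + y₂) = (x₁ - x₂)(x₁² + x₁x₂ + x₂² + A)`, it is `(y₁ - y₂) / (x₁ - x₂)` or
`(x₁² + x₁x₂ + x₂² + A) / (y₁ + y₂)`, whichever denominator is invertible in `K[ε]`; at
`(x₁, y₁) = (x₂, y₂)` the latter is the slope `(3x₁² + A) / (2y₁)` of the tangent. -/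
noncomputable def dualSlope [DecidableEq K] (E : WeierstrassCurve K) (x₁ x₂ y₁ y₂ : K[ε]) : K[ε] :=
  if x₁.fst ≠ x₂.fst then (y₁ - y₂) * (x₁ - x₂)⁻¹ else cubicQuot E x₁ x₂ * (y₁ + y₂)⁻¹

/-- The third point of intersection of the line through two affine points of opposite reductions is
`(w : 1 : 0)`, where `w` is the inverse slope `(x₁ - x₂) / (y₁ - y₂)`, or equivalently
`(y₁ + y₂) / (x₁² + x₁x₂ + x₂² + A)`, whichever denominator is invertible. The sum of the two points
is then `(-w : 1 : 0)`. -/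
noncomputable def dualInvSlope [DecidableEq K] (E : WeierstrassCurve K) (x₁ x₂ y₁ y₂ : K[ε]) :
    K[ε] :=
  if y₁.fst ≠ y₂.fst then (x₁ - x₂) * (y₁ - y₂)⁻¹ else (y₁ + y₂) * (cubicQuot E x₁ x₂)⁻¹

theorem dualSlope_spec [DecidableEq K] [E.IsShortNF] {x₁ y₁ x₂ y₂ : K[ε]}
    (h₁ : (canonicalLift E).toAffine.Equation x₁ y₁)
    (h₂ : (canonicalLift E).toAffine.Equation x₂ y₂)
    (h : ¬ (x₁.fst = x₂.fst ∧ y₁.fst + y₂.fst = 0)) :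
    y₁ - y₂ = dualSlope E x₁ x₂ y₁ y₂ * (x₁ - x₂) ∧
      dualSlope E x₁ x₂ y₁ y₂ * (y₁ + y₂) = cubicQuot E x₁ x₂ := by
  have key := sub_mul_cubicQuot h₁ h₂
  by_cases hx : x₁.fst = x₂.fst
  · have hy : (y₁ + y₂).fst ≠ 0 := fun hy => h ⟨hx, by simpa using hy⟩
    have hi := dual_mul_inv hy
    rw [dualSlope, if_neg (not_not.2 hx)]
    constructor
    · linear_combination (y₁ - y₂) * (-hi) - (y₁ + y₂)⁻¹ * key
    · linear_combination cubicQuot E x₁ x₂ * hi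
  · have hd : (x₁ - x₂).fst ≠ 0 := by simpa [sub_eq_zero] using hx
    have hi := dual_mul_inv hd
    rw [dualSlope, if_pos hx]
    constructor
    · linear_combination (y₁ - y₂) * (-hi)
    · linear_combination cubicQuot E x₁ x₂ * hi - (x₁ - x₂)⁻¹ * key

theorem equation_add [DecidableEq K] [E.IsShortNF] {x₁ y₁ x₂ y₂ m : K[ε]}
    (h₁ : (canonicalLift E).toAffine.Equation x₁ y₁)
    (hm : y₁ - y₂ = m * (x₁ - x₂) ∧ m * (y₁ + y₂) = cubicQuot E x₁ x₂) :
    (canonicalLift E).toAffine.Equation (m ^ 2 - x₁ - x₂)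
      (m * (x₁ - (m ^ 2 - x₁ - x₂)) - y₁) := by
  obtain ⟨hm₁, hm₂⟩ := hm
  rw [equation_iff] at h₁ ⊢
  rw [cubicQuot] at hm₂
  linear_combination h₁ + (m ^ 2 - 2 * x₁ - x₂) * hm₂ + m * (m ^ 2 - 2 * x₁ - x₂) * hm₁

theorem equation_translate [E.IsShortNF] {x y : K[ε]}
    (h : (canonicalLift E).toAffine.Equation x y) (k : K) :
    (canonicalLift E).toAffine.Equation (x - 2 * y * kEps k)
      (y - (3 * x ^ 2 + TrivSqZeroExt.inl E.a₄) * kEps k) := by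
  have hk := kEps_mul_kEps k k
  rw [equation_iff] at h ⊢
  linear_combination h + ((3 * x ^ 2 + TrivSqZeroExt.inl E.a₄) ^ 2 - 12 * x * y ^ 2
    + 8 * y ^ 3 * kEps k) * hk

namespace DualPoint

/-- The chord and tangent addition law over `K[ε]`. The sum of an affine point and `𝒪ₖ` is the
affine point `(x - 2ykε : y - (3x² + A)kε : 1)`. -/
noncomputable def add [DecidableEq K] [E.IsShortNF] : DualPoint E → DualPoint E → DualPoint E
  | inf j, inf k => inf (j + k)
  | affine _ _ h, inf k => affine _ _ (equation_translate h k)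
  | inf k, affine _ _ h => affine _ _ (equation_translate h k)
  | affine x₁ y₁ h₁, affine x₂ y₂ h₂ =>
    if h : x₁.fst = x₂.fst ∧ y₁.fst + y₂.fst = 0 then
      inf (-(dualInvSlope E x₁ x₂ y₁ y₂).snd)
    else
      affine _ _ (equation_add h₁ (dualSlope_spec h₁ h₂ h))

/-- The inverse of `(x : y : 1)` is `(x : -y : 1)`, and the inverse of `(kε : 1 : 0)` is
`(-kε : 1 : 0)`. -/
def neg [E.IsShortNF] : DualPoint E → DualPoint E
  | inf k => inf (-k)
  | affine x y h => affine x (-y) ((equation_iff _ _).2 (by rw [neg_sq, (equation_iff _ _).1 h]))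

instance : Zero (DualPoint E) := ⟨inf 0⟩
noncomputable instance [DecidableEq K] [E.IsShortNF] : Add (DualPoint E) := ⟨add⟩
instance [E.IsShortNF] : Neg (DualPoint E) := ⟨neg⟩

/-- The inclusion of `E(K)` in `Ẽ(K[ε])`. -/
def ofBase : E.toAffine.Point → DualPoint E
  | .zero => inf 0
  | .some x y h => affine (TrivSqZeroExt.inl x) (TrivSqZeroExt.inl y)
      (h.1.map (TrivSqZeroExt.inlHom K K))


theorem fst_two : (2 : K[ε]).fst = 2 := rfl
theorem fst_three : (3 : K[ε]).fst = 3 := rfl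
theorem snd_two : (2 : K[ε]).snd = 0 := by
  rw [← one_add_one_eq_two, TrivSqZeroExt.snd_add, TrivSqZeroExt.snd_one, add_zero]
theorem snd_three : (3 : K[ε]).snd = 0 := by
  rw [← two_add_one_eq_three, TrivSqZeroExt.snd_add, TrivSqZeroExt.snd_one, snd_two, add_zero]

theorem affine_congr {x y x' y' : K[ε]} {h : (canonicalLift E).toAffine.Equation x y}
    {h' : (canonicalLift E).toAffine.Equation x' y'} (hx : x = x') (hy : y = y') :
    affine (E := E) x y h = affine x' y' h' := by
  subst hx hy; rfl

theorem two_ne_zero_of_isElliptic (E : WeierstrassCurve K) [E.IsShortNF] [E.IsElliptic] :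
    (2 : K) ≠ 0 := by
  intro h
  apply E.isUnit_Δ.ne_zero
  rw [E.Δ_of_isShortNF]
  linear_combination (-8 * (4 * E.a₄ ^ 3 + 27 * E.a₆ ^ 2)) * h

theorem deriv_ne_zero [E.IsShortNF] {x : K}
    (h : E.toAffine.Nonsingular x 0) : 3 * x ^ 2 + E.a₄ ≠ 0 := by
  rw [WeierstrassCurve.Affine.nonsingular_iff] at h
  simp at h
  intro h0
  apply h.2
  linear_combination -h0

theorem negY_eq [E.IsShortNF] (x y : K) : E.toAffine.negY x y = -y := by
  simp [WeierstrassCurve.Affine.negY]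

section

variable [DecidableEq K] [E.IsShortNF]

/-- The point `P + 𝒪ₖ`, for `P ∈ E(K)`. -/
noncomputable def translate (P : E.toAffine.Point) (k : K) : DualPoint E := ofBase P + inf k

theorem inf_add_inf (j k : K) : (inf j + inf k : DualPoint E) = inf (j + k) := rfl

theorem translate_zero (k : K) : translate (E := E) 0 k = inf k := by
  change inf (0 + k) = inf k
  rw [zero_add]

theorem affine_add_affine_of_eq {x₁ y₁ x₂ y₂ : K[ε]}
    (h₁ : (canonicalLift E).toAffine.Equation x₁ y₁)
    (h₂ : (canonicalLift E).toAffine.Equation x₂ y₂)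
    (h : x₁.fst = x₂.fst ∧ y₁.fst + y₂.fst = 0) :
    affine (E := E) x₁ y₁ h₁ + affine x₂ y₂ h₂ = inf (-(dualInvSlope E x₁ x₂ y₁ y₂).snd) :=
  dif_pos h

theorem affine_add_affine_of_ne {x₁ y₁ x₂ y₂ : K[ε]}
    (h₁ : (canonicalLift E).toAffine.Equation x₁ y₁)
    (h₂ : (canonicalLift E).toAffine.Equation x₂ y₂)
    (h : ¬ (x₁.fst = x₂.fst ∧ y₁.fst + y₂.fst = 0)) :
    ∃ (m : K[ε]) (h₃ : (canonicalLift E).toAffine.Equation (m ^ 2 - x₁ - x₂)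
      (m * (x₁ - (m ^ 2 - x₁ - x₂)) - y₁)), y₁ - y₂ = m * (x₁ - x₂) ∧
      m * (y₁ + y₂) = cubicQuot E x₁ x₂ ∧
      affine (E := E) x₁ y₁ h₁ + affine x₂ y₂ h₂ = affine _ _ h₃ :=
  ⟨_, equation_add h₁ (dualSlope_spec h₁ h₂ h), (dualSlope_spec h₁ h₂ h).1,
    (dualSlope_spec h₁ h₂ h).2, dif_neg h⟩

theorem translate_add_translate [E.IsElliptic] (P Q : E.toAffine.Point) (j k : K) :
    translate P j + translate Q k = translate (P + Q) (j + k) := by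
  have h2 := two_ne_zero_of_isElliptic E
  rcases P with _ | ⟨x₁, y₁, h₁⟩
  · change translate 0 j + _ = translate (0 + Q) _
    rw [translate_zero, zero_add]
    rcases Q with _ | ⟨x₂, y₂, h₂⟩
    · change _ + translate 0 k = translate 0 _
      rw [translate_zero, translate_zero]; rfl
    · apply affine_congr <;> ext <;> simp <;> ring
  rcases Q with _ | ⟨x₂, y₂, h₂⟩
  · change _ + translate 0 k = translate (_ + 0) _
    rw [translate_zero, add_zero]
    apply affine_congr <;> ext <;> simp <;> ring
  by_cases h : x₁ = x₂ ∧ y₁ = E.toAffine.negY x₂ y₂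
  · rw [WeierstrassCurve.Affine.Point.add_of_Y_eq h.1 h.2, translate_zero]
    obtain ⟨rfl, h⟩ := h
    rw [negY_eq] at h
    obtain rfl : y₂ = -y₁ := by rw [h, neg_neg]
    refine (affine_add_affine_of_eq _ _ (by simp)).trans (congrArg inf ?_)
    rw [dualInvSlope]
    by_cases hy : y₁ = 0
    · subst hy
      have hd := deriv_ne_zero h₁
      rw [if_neg (by simp), cubicQuot]
      have hd' : x₁ ^ 2 + x₁ * x₁ + x₁ ^ 2 + E.a₄ ≠ 0 := by convert hd using 1; ring
      have hd₂ := inv_mul_cancel₀ hd'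
      simp [fst_three]
      linear_combination (j + k) * hd₂
    · have hyy : y₁ ≠ -y₁ := fun e => mul_ne_zero h2 hy (by linear_combination e)
      rw [if_pos (by simpa using hyy)]
      have hd : y₁ + y₁ ≠ 0 := fun e => hyy (by linear_combination e)
      have hd₂ := inv_mul_cancel₀ hd
      simp [fst_two]
      linear_combination (j + k) * hd₂
  · rw [WeierstrassCurve.Affine.Point.add_some h]
    have hne : ¬ (x₁ = x₂ ∧ y₁ + y₂ = 0) := fun e =>
      h ⟨e.1, by rw [negY_eq]; linear_combination e.2⟩
    have e₁ := WeierstrassCurve.Affine.equation_iff .. |>.1 h₁.1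
    have e₂ := WeierstrassCurve.Affine.equation_iff .. |>.1 h₂.1
    simp at e₁ e₂
    set X₁ : K[ε] := TrivSqZeroExt.inl x₁ - 2 * TrivSqZeroExt.inl y₁ * kEps j with hX₁
    set Y₁ : K[ε] := TrivSqZeroExt.inl y₁ -
      (3 * TrivSqZeroExt.inl x₁ ^ 2 + TrivSqZeroExt.inl E.a₄) * kEps j with hY₁
    set X₂ : K[ε] := TrivSqZeroExt.inl x₂ - 2 * TrivSqZeroExt.inl y₂ * kEps k with hX₂
    set Y₂ : K[ε] := TrivSqZeroExt.inl y₂ -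
      (3 * TrivSqZeroExt.inl x₂ ^ 2 + TrivSqZeroExt.inl E.a₄) * kEps k with hY₂
    have H₁ : (canonicalLift E).toAffine.Equation X₁ Y₁ :=
      equation_translate (h₁.1.map (TrivSqZeroExt.inlHom K K)) j
    have H₂ : (canonicalLift E).toAffine.Equation X₂ Y₂ :=
      equation_translate (h₂.1.map (TrivSqZeroExt.inlHom K K)) k
    have hXY : ¬ (X₁.fst = X₂.fst ∧ Y₁.fst + Y₂.fst = 0) := by
      simpa [hX₁, hX₂, hY₁, hY₂] using hne
    obtain ⟨M, h₃, s₁, s₂, hadd⟩ := affine_add_affine_of_ne H₁ H₂ hXY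
    refine hadd.trans ?_
    clear hadd
    have a₁ := congrArg TrivSqZeroExt.fst s₁
    have a₂ := congrArg TrivSqZeroExt.snd s₁
    have b₁ := congrArg TrivSqZeroExt.fst s₂
    have b₂ := congrArg TrivSqZeroExt.snd s₂
    simp [hX₁, hX₂, hY₁, hY₂, cubicQuot, fst_two, fst_three] at a₁ a₂ b₁ b₂
    set m := M.fst with hm
    set n := M.snd with hn
    have hslope : E.toAffine.slope x₁ x₂ y₁ y₂ = m := by
      by_cases hx : x₁ = x₂
      · subst hx
        have hy : y₁ + y₂ ≠ 0 := fun e => hne ⟨rfl, e⟩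
        have hy' : y₁ = y₂ := by linear_combination a₁
        subst hy'
        rw [WeierstrassCurve.Affine.slope_of_Y_ne rfl (by
          rw [negY_eq]; exact fun e => hy (by linear_combination e)), negY_eq, div_eq_iff (by
          simpa using hy)]
        simp
        linear_combination -b₁
      · rw [WeierstrassCurve.Affine.slope_of_X_ne hx, div_eq_iff (sub_ne_zero.2 hx)]
        exact a₁
    have hn' : n = (m ^ 2 - 2 * x₁ - x₂) * j + (m ^ 2 - x₁ - 2 * x₂) * k := by
      by_cases hx : x₁ = x₂
      · subst hx
        have hy : y₁ + y₂ ≠ 0 := fun e => hne ⟨rfl, e⟩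
        have hy' : y₁ = y₂ := by linear_combination a₁
        subst hy'
        apply mul_right_cancel₀ hy
        linear_combination b₂ - (m * (j + k)) * b₁
      · apply mul_right_cancel₀ (sub_ne_zero.2 hx)
        linear_combination -a₂ + (j - k) * b₁ + m * (j + k) * a₁
    apply affine_congr
    · ext
      · simp [hX₁, hX₂, hslope, ← hm, WeierstrassCurve.Affine.addX]
      · simp [hX₁, hX₂, hslope, ← hm, ← hn, WeierstrassCurve.Affine.addX,
          WeierstrassCurve.Affine.addY, fst_two, WeierstrassCurve.Affine.negAddY]
        linear_combination 2 * m * hn' - 2 * k * a₁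
    · ext
      · simp [hX₁, hX₂, hY₁, hslope, ← hm, WeierstrassCurve.Affine.addX,
          WeierstrassCurve.Affine.addY, WeierstrassCurve.Affine.negAddY]
        ring
      · simp [hX₁, hX₂, hY₁, hslope, ← hm, ← hn, WeierstrassCurve.Affine.addX,
          fst_two, fst_three]
        linear_combination (x₁ - (m ^ 2 - x₁ - x₂) - 2 * m ^ 2) * hn' - (2 * j + k) * b₁
          + (k - 2 * j) * m * a₁

theorem translate_surjective [E.IsElliptic] (P : DualPoint E) : ∃ Q k, P = translate Q k := by
  have h2 := two_ne_zero_of_isElliptic E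
  rcases P with ⟨x, y, h⟩ | k
  · have h' := (equation_iff x y).1 h
    have a₀ := congrArg TrivSqZeroExt.fst h'
    have a₁ := congrArg TrivSqZeroExt.snd h'
    simp [pow_succ] at a₀ a₁
    have hE : E.toAffine.Equation x.fst y.fst := by
      rw [WeierstrassCurve.Affine.equation_iff]
      simp
      linear_combination a₀
    have hN := WeierstrassCurve.Affine.equation_iff_nonsingular.1 hE
    by_cases hy : y.fst = 0
    · have hd : 3 * x.fst ^ 2 + E.a₄ ≠ 0 := deriv_ne_zero (by rw [← hy]; exact hN)
      refine ⟨.some _ _ hN, -y.snd / (3 * x.fst ^ 2 + E.a₄), affine_congr ?_ ?_⟩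
      · ext
        · simp
        · simp [hy]
          apply mul_left_cancel₀ hd
          rw [hy] at a₁
          linear_combination -a₁
      · ext
        · simp
        · simp [fst_three]
          field_simp
    · refine ⟨.some _ _ hN, -x.snd / (2 * y.fst), affine_congr ?_ ?_⟩
      · ext
        · simp
        · simp [fst_two]
          field_simp
      · ext
        · simp
        · simp [fst_three]
          field_simp
          linear_combination a₁
  · exact ⟨0, k, (translate_zero k).symm⟩

theorem translate_zero_right (P : E.toAffine.Point) : translate P 0 = ofBase P := by
  rcases P with _ | ⟨x, y, h⟩
  · exact translate_zero 0
  · apply affine_congr <;> ext <;> simp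

theorem neg_translate (P : E.toAffine.Point) (k : K) : -translate P k = translate (-P) (-k) := by
  rcases P with _ | ⟨x, y, h⟩
  · change -translate 0 k = translate (-0) (-k)
    rw [translate_zero, neg_zero, translate_zero]; rfl
  · rw [WeierstrassCurve.Affine.Point.neg_some]
    apply affine_congr <;> ext <;> simp

noncomputable instance [E.IsElliptic] : AddCommGroup (DualPoint E) where
  add_assoc P Q R := by
    obtain ⟨P, i, rfl⟩ := translate_surjective P
    obtain ⟨Q, j, rfl⟩ := translate_surjective Q
    obtain ⟨R, k, rfl⟩ := translate_surjective R
    simp only [translate_add_translate, add_assoc]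
  zero_add P := by
    obtain ⟨P, i, rfl⟩ := translate_surjective P
    rw [show (0 : DualPoint E) = translate 0 0 from (translate_zero 0).symm,
      translate_add_translate, zero_add, zero_add]
  add_zero P := by
    obtain ⟨P, i, rfl⟩ := translate_surjective P
    rw [show (0 : DualPoint E) = translate 0 0 from (translate_zero 0).symm,
      translate_add_translate, add_zero, add_zero]
  neg_add_cancel P := by
    obtain ⟨P, i, rfl⟩ := translate_surjective P
    rw [neg_translate, translate_add_translate, neg_add_cancel, neg_add_cancel]
    exact translate_zero 0
  add_comm P Q := by
    obtain ⟨P, i, rfl⟩ := translate_surjective P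
    obtain ⟨Q, j, rfl⟩ := translate_surjective Q
    rw [translate_add_translate, translate_add_translate, add_comm P, add_comm i]
  nsmul := nsmulRec
  zsmul := zsmulRec

variable [E.IsElliptic]

/-- The inclusion of `E(K)` in `Ẽ(K[ε])` as a homomorphism. -/
noncomputable def ofBaseHom : E.toAffine.Point →+ DualPoint E where
  toFun := ofBase
  map_zero' := rfl
  map_add' P Q := by
    rw [← translate_zero_right, ← translate_zero_right, ← translate_zero_right,
      translate_add_translate, add_zero]

/-- `k ↦ 𝒪ₖ` as a homomorphism; its range is `Θ`. -/
noncomputable def infHom : K →+ DualPoint E where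
  toFun := inf
  map_zero' := rfl
  map_add' _ _ := rfl

end

end DualPoint

section Pairing

variable [DecidableEq K] [E.IsShortNF] [E.IsElliptic]

/-- `E(K)[p]`. -/
abbrev BaseTorsion (E : WeierstrassCurve K) (p : ℕ) : AddSubgroup E.toAffine.Point :=
  AddSubgroup.torsionBy E.toAffine.Point (p : ℤ)

/-- `Ẽ(K[ε])[p]`. -/
noncomputable abbrev DualTorsion (E : WeierstrassCurve K) [E.IsShortNF] [E.IsElliptic] (p : ℕ) :
    AddSubgroup (DualPoint E) :=
  AddSubgroup.torsionBy (DualPoint E) (p : ℤ)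

/-- The inclusion of `E[p]` in `Ẽ[p]`. -/
noncomputable def baseTorsion {p : ℕ} (P : BaseTorsion E p) : DualTorsion E p :=
  ⟨DualPoint.ofBaseHom P.1, AddSubgroup.torsionBy.nsmul_iff.2 (by
    rw [← map_nsmul, AddSubgroup.torsionBy.nsmul_iff.1 P.2, map_zero])⟩

/-- The point `𝒪ₖ ∈ Θ` as an element of `Ẽ[p]`. -/
noncomputable def thetaTorsion (E : WeierstrassCurve K) [E.IsShortNF] [E.IsElliptic] (p : ℕ)
    [CharP K p] (k : K) : DualTorsion E p :=
  ⟨DualPoint.infHom k, AddSubgroup.torsionBy.nsmul_iff.2 (by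
    rw [← map_nsmul, nsmul_eq_mul, CharP.cast_eq_zero, zero_mul, map_zero])⟩

/-- The left side, at `(X, Y) ∈ K[ε]²`, of the normalized affine equation of the line through two
points of `E(K)`: `Y - mX - b` if the line is not vertical and `X - c` if it is. (The line through
the point at infinity twice is `Z = 0`, with affine equation `1`.) -/
noncomputable def lineEval : E.toAffine.Point → E.toAffine.Point → K[ε] → K[ε] → K[ε]
  | .zero, .zero, _, _ => 1
  | .zero, .some x _ _, X, _ => X - TrivSqZeroExt.inl x
  | .some x _ _, .zero, X, _ => X - TrivSqZeroExt.inl x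
  | .some x₁ y₁ _, .some x₂ y₂ _, X, Y =>
    if x₁ = x₂ ∧ y₁ = -y₂ then X - TrivSqZeroExt.inl x₁
    else Y - TrivSqZeroExt.inl y₁ -
      TrivSqZeroExt.inl (E.toAffine.slope x₁ x₂ y₁ y₂) * (X - TrivSqZeroExt.inl x₁)

/-- The value at a point of `Ẽ(K[ε])` of the line through `P, Q ∈ E(K)`. The value is meaningful
at affine points only, and lines are used at affine points only. -/
noncomputable def lineAt (P Q : E.toAffine.Point) : DualPoint E → K[ε]
  | .affine X Y _ => lineEval P Q X Y
  | .inf _ => 0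

/-- The value at a point of `Ẽ(K[ε])` of the vertical line through `P ∈ E(K)`. -/
noncomputable def vertAt (P : E.toAffine.Point) : DualPoint E → K[ε] := lineAt P (-P)

/-- Miller's function `h_{i,j}` for `P ∈ E[p]` and the translation `τ` by `-T`, evaluated at a point
of `Ẽ(K[ε])`: it is `(ℓ_{i,j} / v_{i+j}) ∘ τ` if `i + j ≠ p` and `v_i ∘ τ` if `i + j = p`. -/
noncomputable def millerH (p : ℕ) (P T : E.toAffine.Point) (i j : ℕ) (Q : DualPoint E) : K[ε] :=
  if i + j = p then vertAt (i • P) (Q - DualPoint.ofBase T)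
  else lineAt (i • P) (j • P) (Q - DualPoint.ofBase T) *
    (vertAt ((i + j) • P) (Q - DualPoint.ofBase T))⁻¹

end Pairing

/-- `S` is an addition chain for `n`. -/
structure IsAdditionChain (n : ℕ) (S : Finset ℕ) : Prop where
  subset : S ⊆ Finset.Icc 1 n
  mem : n ∈ S
  exists_add : ∀ k ∈ S, 1 < k → ∃ i ∈ S, ∃ j ∈ S, i + j = k

/-- The sequence `C` of steps `i + j ↦ i, j` with `i, j, i + j ∈ S` decomposes the multiset `M` into
ones. A step `i + j ↦ i, j` is recorded as the pair `(i, j)`, and replaces one occurrence of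
`i + j` by `i` and `j`. -/
inductive Decomposes (S : Finset ℕ) : Multiset ℕ → List (ℕ × ℕ) → Prop
  | ones (m : ℕ) : Decomposes S (Multiset.replicate m 1) []
  | step {i j : ℕ} {M : Multiset ℕ} {C : List (ℕ × ℕ)} (hi : i ∈ S) (hj : j ∈ S)
      (hij : i + j ∈ S) (h : Decomposes S (i ::ₘ j ::ₘ M) C) :
      Decomposes S ((i + j) ::ₘ M) ((i, j) :: C)

/-- `C` is an addition chain decomposition of `n`. -/
def IsAdditionChainDecomposition (n : ℕ) (C : List (ℕ × ℕ)) : Prop :=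
  ∃ S, IsAdditionChain n S ∧ Decomposes S {n} C

section Pairing

variable [DecidableEq K] [E.IsShortNF] [E.IsElliptic]

/-- The map `e(P, 𝒪ₖ) = ∏_C h_{i,j}(𝒪ₖ + R) / h_{i,j}(R)` on `E[p] × Θ`, with value `1` if `P` or
`𝒪ₖ` is the point at infinity `𝒪₀`. -/
noncomputable def millerPairing {p : ℕ} (C : List (ℕ × ℕ)) (R T : E.toAffine.Point)
    (P : BaseTorsion E p) (k : K) : K[ε] :=
  if P = 0 ∨ k = 0 then 1
  else (C.map fun s =>
    millerH p P.1 T s.1 s.2 (DualPoint.inf k + DualPoint.ofBase R) *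
      (millerH p P.1 T s.1 s.2 (DualPoint.ofBase R))⁻¹).prod

/-- `ep : Ẽ[p] × Ẽ[p] → μ_p(K[ε])` is bilinear, antisymmetric, trivial on `E[p] × E[p]` and on
`Θ × Θ`, and extends the map `e` on `E[p] × Θ`. -/
structure IsWeilExtension {p : ℕ} [CharP K p] (e : BaseTorsion E p → K → K[ε])
    (ep : DualTorsion E p → DualTorsion E p → rootsOfUnity p K[ε]) : Prop where
  extends_e : ∀ P k, ((ep (baseTorsion P) (thetaTorsion E p k) : K[ε]ˣ) : K[ε]) = e P k
  base_base : ∀ P Q, ep (baseTorsion P) (baseTorsion Q) = 1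
  theta_theta : ∀ j k, ep (thetaTorsion E p j) (thetaTorsion E p k) = 1
  add_left : ∀ P P' Q, ep (P + P') Q = ep P Q * ep P' Q
  add_right : ∀ P Q Q', ep P (Q + Q') = ep P Q * ep P Q'
  antisymm : ∀ P Q, ep P Q = (ep Q P)⁻¹

end Pairing

end DualCurve

namespace DualCurve

open WeierstrassCurve TrivSqZeroExt Polynomial

section LogDerivative

variable {L : Type*} [Field L]

/-- The logarithmic derivative `b / a` of the dual number `a + bε`. -/
noncomputable def dlog (a : L[ε]) : L := a.snd / a.fst

theorem dlog_one : dlog (1 : L[ε]) = 0 := by simp [dlog]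

theorem dlog_mul {a b : L[ε]} (ha : a.fst ≠ 0) (hb : b.fst ≠ 0) :
    dlog (a * b) = dlog a + dlog b := by
  simp only [dlog, DualNumber.snd_mul, TrivSqZeroExt.fst_mul]
  field_simp
  ring

theorem dlog_inv {a : L[ε]} (ha : a.fst ≠ 0) : dlog a⁻¹ = -dlog a := by
  simp only [dlog, TrivSqZeroExt.snd_inv, TrivSqZeroExt.fst_inv, smul_eq_mul,
    MulOpposite.smul_eq_mul_unop, MulOpposite.unop_op]
  field_simp

theorem dlog_pow {a : L[ε]} (ha : a.fst ≠ 0) (n : ℕ) : dlog (a ^ n) = n * dlog a := by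
  induction n with
  | zero => simp [dlog_one]
  | succ n ih =>
    rw [pow_succ, dlog_mul (by simpa [TrivSqZeroExt.fst_pow] using fun h => absurd h ha) ha, ih]
    push_cast; ring

theorem line_log_deriv_identity {X Y k s a b c d A B : L}
    (hXY : Y ^ 2 = X ^ 3 + A * X + B)
    (key : X ^ 3 + A * X + B = (d + s * (X - a)) ^ 2 + (X - a) * (X - b) * (X - c))
    (key' : 3 * X ^ 2 + A = 2 * s * (d + s * (X - a)) + (X - b) * (X - c) + (X - a) * (X - c) +
      (X - a) * (X - b))
    (ha : X - a ≠ 0) (hb : X - b ≠ 0) (hc : X - c ≠ 0) (hm : Y - (d + s * (X - a)) ≠ 0) :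
    (-(3 * X ^ 2 + A) * k - s * (-2 * Y * k)) / (Y - (d + s * (X - a))) =
      -k * (s + (Y + d) / (X - a) + (Y + (d + s * (b - a))) / (X - b) +
        (Y + (d + s * (c - a))) / (X - c)) := by
  set M := d + s * (X - a) with hM
  have e1 : (Y + d) / (X - a) = (Y + M) / (X - a) - s := by rw [hM]; field_simp; ring
  have e2 : (Y + (d + s * (b - a))) / (X - b) = (Y + M) / (X - b) - s := by
    rw [hM]; field_simp; ring
  have e3 : (Y + (d + s * (c - a))) / (X - c) = (Y + M) / (X - c) - s := by
    rw [hM]; field_simp; ring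
  have e4 : (Y - M) * (Y + M) = (X - a) * (X - b) * (X - c) := by linear_combination hXY + key
  rw [e1, e2, e3, key', div_eq_iff hm]
  have e5 : (Y + M) / (X - a) * (Y - M) = (X - b) * (X - c) := by
    rw [div_mul_eq_mul_div, div_eq_iff ha]; linear_combination e4
  have e6 : (Y + M) / (X - b) * (Y - M) = (X - a) * (X - c) := by
    rw [div_mul_eq_mul_div, div_eq_iff hb]; linear_combination e4
  have e7 : (Y + M) / (X - c) * (Y - M) = (X - a) * (X - b) := by
    rw [div_mul_eq_mul_div, div_eq_iff hc]; linear_combination e4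
  linear_combination k * (e5 + e6 + e7)

end LogDerivative

section Lines

variable {K : Type*} [Field K] [DecidableEq K] {E : WeierstrassCurve K}

/-- The value at `(X, Y) ∈ A²` of the normalized equation of the line through two points of `E(K)`,
for any `K`-algebra `A`. -/
noncomputable def lineVal {A : Type*} [CommRing A] [Algebra K A] :
    E.toAffine.Point → E.toAffine.Point → A → A → A
  | .zero, .zero, _, _ => 1
  | .zero, .some x _ _, X, _ => X - algebraMap K A x
  | .some x _ _, .zero, X, _ => X - algebraMap K A x
  | .some x₁ y₁ _, .some x₂ y₂ _, X, Y =>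
    if x₁ = x₂ ∧ y₁ = -y₂ then X - algebraMap K A x₁
    else Y - algebraMap K A y₁ -
      algebraMap K A (E.toAffine.slope x₁ x₂ y₁ y₂) * (X - algebraMap K A x₁)

theorem lineEval_eq_lineVal (P Q : E.toAffine.Point) (X Y : K[ε]) :
    lineEval P Q X Y = lineVal P Q X Y := by
  rcases P with _ | ⟨x₁, y₁, h₁⟩ <;> rcases Q with _ | ⟨x₂, y₂, h₂⟩ <;> rfl

theorem map_lineVal {A B : Type*} [CommRing A] [Algebra K A] [CommRing B] [Algebra K B]
    (f : A →ₐ[K] B) (P Q : E.toAffine.Point) (X Y : A) :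
    f (lineVal P Q X Y) = lineVal P Q (f X) (f Y) := by
  rcases P with _ | ⟨x₁, y₁, h₁⟩ <;> rcases Q with _ | ⟨x₂, y₂, h₂⟩ <;>
    simp only [lineVal, map_one, map_sub, AlgHom.commutes]
  split_ifs <;> simp

/-- The slope of the line through two points of `E(K)`, with value `0` if the line is vertical or
one of the points is the point at infinity. -/
noncomputable def slopeOrZero : E.toAffine.Point → E.toAffine.Point → K
  | .some x₁ y₁ _, .some x₂ y₂ _ =>
    if x₁ = x₂ ∧ y₁ = -y₂ then 0 else E.toAffine.slope x₁ x₂ y₁ y₂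
  | _, _ => 0

variable {L : Type*} [Field L] [Algebra K L]

/-- The slope of the line through `(X, Y)` and `-P`, as a function of `(X, Y)`, with value `0` if `P`
is the point at infinity. -/
noncomputable def chordSlope : E.toAffine.Point → L → L → L
  | .zero, _, _ => 0
  | .some x y _, X, Y => (Y + algebraMap K L y) / (X - algebraMap K L x)

/-- `X` is not the `x`-coordinate of `P`. -/
def IsAway : E.toAffine.Point → L → Prop
  | .zero, _ => True
  | .some x _ _, X => X ≠ algebraMap K L x

theorem y_eq_add_slope_mul {x₁ y₁ x₂ y₂ : K} (h₁ : E.toAffine.Equation x₁ y₁)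
    (h₂ : E.toAffine.Equation x₂ y₂) (h : ¬ (x₁ = x₂ ∧ y₁ = E.toAffine.negY x₂ y₂)) :
    y₂ = y₁ + E.toAffine.slope x₁ x₂ y₁ y₂ * (x₂ - x₁) := by
  by_cases hx : x₁ = x₂
  · have := WeierstrassCurve.Affine.Y_eq_of_Y_ne h₁ h₂ hx fun e => h ⟨hx, e⟩
    simp [hx, this]
  · rw [WeierstrassCurve.Affine.slope_of_X_ne hx]
    field_simp [sub_ne_zero.2 hx]
    ring

variable [E.IsShortNF]

theorem cubic_eq_line_sq_add {x₁ y₁ x₂ y₂ : K} (h₁ : E.toAffine.Equation x₁ y₁)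
    (h₂ : E.toAffine.Equation x₂ y₂) (h : ¬ (x₁ = x₂ ∧ y₁ = E.toAffine.negY x₂ y₂)) :
    (X ^ 3 + C E.a₄ * X + C E.a₆ : Polynomial K) =
      (C y₁ + C (E.toAffine.slope x₁ x₂ y₁ y₂) * (X - C x₁)) ^ 2 + (X - C x₁) * (X - C x₂) *
        (X - C (E.toAffine.addX x₁ x₂ (E.toAffine.slope x₁ x₂ y₁ y₂))) := by
  have := WeierstrassCurve.Affine.addPolynomial_slope h₁ h₂ h
  rw [WeierstrassCurve.Affine.addPolynomial, WeierstrassCurve.Affine.polynomial,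
    WeierstrassCurve.Affine.linePolynomial] at this
  simp at this
  simp [WeierstrassCurve.Affine.addX]
  linear_combination -this

theorem dlog_lineVal {X Y k : L}
    (hXY : Y ^ 2 = X ^ 3 + algebraMap K L E.a₄ * X + algebraMap K L E.a₆)
    {U V : L[ε]} (hU : U.fst = X) (hU' : U.snd = -2 * Y * k) (hV : V.fst = Y)
    (hV' : V.snd = -(3 * X ^ 2 + algebraMap K L E.a₄) * k)
    {P Q : E.toAffine.Point} (hP : IsAway P X) (hQ : IsAway Q X) (hPQ : IsAway (P + Q) X) :
    (lineVal P Q U V).fst ≠ 0 ∧ dlog (lineVal P Q U V) = -k * (algebraMap K L (slopeOrZero P Q) +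
      chordSlope P X Y + chordSlope Q X Y + chordSlope (-(P + Q)) X Y) := by
  have vert : ∀ x y : K, X ≠ algebraMap K L x → (U - algebraMap K L[ε] x).fst ≠ 0 ∧
      dlog (U - algebraMap K L[ε] x) = -k * ((Y + algebraMap K L y) / (X - algebraMap K L x) +
        (Y - algebraMap K L y) / (X - algebraMap K L x)) := by
    intro x y h
    have h' := sub_ne_zero.2 h
    rw [TrivSqZeroExt.algebraMap_eq_inl']
    simp [hU, h', dlog, hU']
    field_simp
    ring
  rcases P with _ | ⟨x₁, y₁, h₁⟩
  · rw [← WeierstrassCurve.Affine.Point.zero_def, zero_add] at *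
    rcases Q with _ | ⟨x₂, y₂, h₂⟩
    · rw [← WeierstrassCurve.Affine.Point.zero_def, neg_zero]
      simp [lineVal, dlog_one, chordSlope, slopeOrZero]
    · simpa [WeierstrassCurve.Affine.Point.zero_def, lineVal, chordSlope, slopeOrZero,
        DualPoint.negY_eq, ← sub_eq_add_neg] using vert x₂ y₂ hQ
  rcases Q with _ | ⟨x₂, y₂, h₂⟩
  · rw [← WeierstrassCurve.Affine.Point.zero_def, add_zero] at *
    simpa [WeierstrassCurve.Affine.Point.zero_def, lineVal, chordSlope, slopeOrZero,
        DualPoint.negY_eq, ← sub_eq_add_neg] using vert x₁ y₁ hP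
  by_cases h : x₁ = x₂ ∧ y₁ = -y₂
  · have h' := h
    rw [← DualPoint.negY_eq (E := E) x₂] at h'
    rw [WeierstrassCurve.Affine.Point.add_of_Y_eq h'.1 h'.2]
    obtain ⟨rfl, rfl⟩ := h
    simpa [WeierstrassCurve.Affine.Point.zero_def, lineVal, chordSlope, slopeOrZero,
        DualPoint.negY_eq, sub_eq_add_neg,
        ← WeierstrassCurve.Affine.Point.zero_def] using vert x₁ (-y₂) hP
  · have h' := h
    rw [← DualPoint.negY_eq (E := E) x₂] at h'
    have key := cubic_eq_line_sq_add h₁.1 h₂.1 h'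
    rw [WeierstrassCurve.Affine.Point.add_some h'] at hPQ ⊢
    rw [WeierstrassCurve.Affine.Point.neg_some]
    have key' := congrArg (fun q => aeval X (derivative q)) key
    replace key := congrArg (aeval X) key
    simp only [IsAway, lineVal, chordSlope, slopeOrZero, if_neg h, DualPoint.negY_eq,
      WeierstrassCurve.Affine.addY, WeierstrassCurve.Affine.negAddY, map_neg, map_add,
      map_mul, map_sub, TrivSqZeroExt.algebraMap_eq_inl', map_pow, derivative_mul,
      derivative_pow, derivative_X, derivative_C, aeval_X, aeval_C,
      map_one, map_zero, map_natCast] at hP hQ hPQ key key' ⊢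
    set s := algebraMap K L (E.toAffine.slope x₁ x₂ y₁ y₂)
    set a := algebraMap K L x₁
    set b := algebraMap K L x₂
    set c := algebraMap K L (E.toAffine.addX x₁ x₂ (E.toAffine.slope x₁ x₂ y₁ y₂))
    set d := algebraMap K L y₁
    have hy := congrArg (algebraMap K L) (y_eq_add_slope_mul h₁.1 h₂.1 h')
    simp only [map_add, map_mul, map_sub] at hy
    rw [hy]
    have ha := sub_ne_zero.2 hP
    have hb := sub_ne_zero.2 hQ
    have hc := sub_ne_zero.2 hPQ
    have hm : Y - (d + s * (X - a)) ≠ 0 := fun hm => mul_ne_zero (mul_ne_zero ha hb) hc <| by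
      linear_combination (Y + (d + s * (X - a))) * hm - hXY - key
    have hfst : (V - inl d - inl s * (U - inl a)).fst = Y - (d + s * (X - a)) := by
      simp [hU, hV]; ring
    have hsnd : (V - inl d - inl s * (U - inl a)).snd =
        -(3 * X ^ 2 + algebraMap K L E.a₄) * k - s * (-2 * Y * k) := by
      simp [hU', hV']
    refine ⟨by rwa [hfst], ?_⟩
    push_cast at key'
    rw [dlog, hfst, hsnd,
      line_log_deriv_identity hXY key (by linear_combination key') ha hb hc hm]
    congr 3
    ring

end Lines

end DualCurve

namespace DualCurve

open WeierstrassCurve TrivSqZeroExt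

section Miller

variable {K : Type*} [Field K] {E : WeierstrassCurve K}
variable {L : Type*} [Field L] [Algebra K L]

theorem isAway_neg {P : E.toAffine.Point} {X : L} (h : IsAway P X) : IsAway (-P) X := by
  rcases P with _ | ⟨x, y, _⟩ <;> exact h

theorem dlog_list_prod {ι : Type*} (l : List ι) (f : ι → L[ε]) (h : ∀ i ∈ l, (f i).fst ≠ 0) :
    (l.map f).prod.fst ≠ 0 ∧ dlog (l.map f).prod = (l.map fun i => dlog (f i)).sum := by
  induction l with
  | nil => simp [dlog_one]
  | cons a l ih =>
    have ha := h a (by simp)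
    obtain ⟨h₁, h₂⟩ := ih fun i hi => h i (by simp [hi])
    simp only [List.map_cons, List.prod_cons, List.sum_cons]
    exact ⟨by simpa using ⟨ha, h₁⟩, by rw [dlog_mul ha h₁, h₂]⟩

theorem list_prod_eq_one_add_inr (l : List (ℕ × ℕ)) (f : ℕ × ℕ → K[ε])
    (h : ∀ i, (f i).fst = 1) : (l.map f).prod = 1 + inr (l.map fun i => dlog (f i)).sum := by
  induction l with
  | nil => simp
  | cons a l ih =>
    simp only [List.map_cons, List.prod_cons, List.sum_cons, ih]
    ext <;> simp [h, dlog, add_comm]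

variable [DecidableEq K]

/-- The value of the quotient of the line through `P` and `Q` by the vertical line through `P + Q`,
at a point with dual number coordinates. -/
noncomputable def lineQuot (P Q : E.toAffine.Point) (U V : L[ε]) : L[ε] :=
  lineVal P Q U V * (lineVal (P + Q) (-(P + Q)) U V)⁻¹

/-- The sum over the steps `i + j ↦ i, j` in `C` of the slopes of the lines through `iP` and `jP`. -/
noncomputable def slopeSum (C : List (ℕ × ℕ)) (P : E.toAffine.Point) : K :=
  (C.map fun s => slopeOrZero (s.1 • P) (s.2 • P)).sum

theorem slopeSum_zero (C : List (ℕ × ℕ)) : slopeSum C (0 : E.toAffine.Point) = 0 := by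
  have h : slopeOrZero (0 : E.toAffine.Point) 0 = 0 := rfl
  simp [slopeSum, h]

theorem fst_lineQuot (P Q : E.toAffine.Point) (U V : L[ε]) :
    (lineQuot P Q U V).fst = lineVal P Q U.fst V.fst *
      (lineVal (P + Q) (-(P + Q)) U.fst V.fst)⁻¹ := by
  have h : ∀ P Q : E.toAffine.Point, (lineVal P Q U V).fst = lineVal P Q U.fst V.fst :=
    fun P Q => map_lineVal (fstHom K L L) P Q U V
  rw [lineQuot, TrivSqZeroExt.fst_mul, TrivSqZeroExt.fst_inv, h, h]

variable [E.IsShortNF]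

theorem slopeOrZero_neg_right (P : E.toAffine.Point) : slopeOrZero P (-P) = 0 := by
  rcases P with _ | ⟨x, y, _⟩
  · rfl
  · rw [WeierstrassCurve.Affine.Point.neg_some]
    simp [slopeOrZero]

theorem dlog_lineQuot {X Y k : L}
    (hXY : Y ^ 2 = X ^ 3 + algebraMap K L E.a₄ * X + algebraMap K L E.a₆)
    {U V : L[ε]} (hU : U.fst = X) (hU' : U.snd = -2 * Y * k) (hV : V.fst = Y)
    (hV' : V.snd = -(3 * X ^ 2 + algebraMap K L E.a₄) * k)
    {P Q : E.toAffine.Point} (hP : IsAway P X) (hQ : IsAway Q X) (hPQ : IsAway (P + Q) X) :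
    (lineQuot P Q U V).fst ≠ 0 ∧ dlog (lineQuot P Q U V) = -k * (algebraMap K L (slopeOrZero P Q) +
      chordSlope P X Y + chordSlope Q X Y - chordSlope (P + Q) X Y) := by
  obtain ⟨h₁, h₂⟩ := dlog_lineVal hXY hU hU' hV hV' hP hQ hPQ
  obtain ⟨h₃, h₄⟩ := dlog_lineVal hXY hU hU' hV hV' hPQ (isAway_neg hPQ)
    (by rw [add_neg_cancel]; trivial)
  rw [slopeOrZero_neg_right, add_neg_cancel, neg_zero] at h₄
  have h₅ : (lineVal (P + Q) (-(P + Q)) U V)⁻¹.fst ≠ 0 := by simpa using h₃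
  refine ⟨mul_ne_zero h₁ h₅, ?_⟩
  rw [lineQuot, dlog_mul h₁ h₅, dlog_inv h₃, h₂, h₄, map_zero,
    show chordSlope (0 : E.toAffine.Point) X Y = 0 from rfl]
  ring

theorem sum_dlog_lineQuot_eq {X Y k : L}
    (hXY : Y ^ 2 = X ^ 3 + algebraMap K L E.a₄ * X + algebraMap K L E.a₆)
    {U V : L[ε]} (hU : U.fst = X) (hU' : U.snd = -2 * Y * k) (hV : V.fst = Y)
    (hV' : V.snd = -(3 * X ^ 2 + algebraMap K L E.a₄) * k)
    {P : E.toAffine.Point} (hP : ∀ n : ℕ, IsAway (n • P) X)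
    {S : Finset ℕ} {M : Multiset ℕ} {C : List (ℕ × ℕ)} (hC : Decomposes S M C) :
    (C.map fun s => dlog (lineQuot (s.1 • P) (s.2 • P) U V)).sum =
      -k * (algebraMap K L (slopeSum C P) + M.sum * chordSlope P X Y -
        (M.map fun n => chordSlope (n • P) X Y).sum) := by
  induction hC with
  | ones m => simp [slopeSum]
  | @step i j M C hi hj hij h ih =>
    have := (dlog_lineQuot hXY hU hU' hV hV' (hP i) (hP j)
      (by rw [← add_smul]; exact hP _)).2
    simp only [slopeSum, List.map_cons, List.sum_cons, Multiset.sum_cons, Multiset.map_cons,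
      map_add] at ih ⊢
    rw [ih, this, add_smul]
    push_cast
    ring

theorem sum_dlog_lineQuot {p : ℕ} [CharP L p] {X Y k : L}
    (hXY : Y ^ 2 = X ^ 3 + algebraMap K L E.a₄ * X + algebraMap K L E.a₆)
    {U V : L[ε]} (hU : U.fst = X) (hU' : U.snd = -2 * Y * k) (hV : V.fst = Y)
    (hV' : V.snd = -(3 * X ^ 2 + algebraMap K L E.a₄) * k)
    {P : E.toAffine.Point} (hP : ∀ n : ℕ, IsAway (n • P) X) (hp : p • P = 0)
    {S : Finset ℕ} {C : List (ℕ × ℕ)} (hC : Decomposes S {p} C) :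
    (C.map fun s => dlog (lineQuot (s.1 • P) (s.2 • P) U V)).sum =
      -k * algebraMap K L (slopeSum C P) := by
  rw [sum_dlog_lineQuot_eq hXY hU hU' hV hV' hP hC]
  simp [hp, show chordSlope (0 : E.toAffine.Point) X Y = 0 from rfl]

theorem lineAt_translate_some {x y : K} (h : E.toAffine.Nonsingular x y) (k : K)
    (P Q : E.toAffine.Point) :
    lineAt P Q (DualPoint.translate (.some x y h) k) = lineVal P Q (inl x - 2 * inl y * kEps k)
      (inl y - (3 * inl x ^ 2 + inl E.a₄) * kEps k) :=
  lineEval_eq_lineVal ..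

variable [E.IsElliptic]

theorem inf_add_ofBase_sub_ofBase (k : K) (R T : E.toAffine.Point) :
    DualPoint.inf k + DualPoint.ofBase R - DualPoint.ofBase T = DualPoint.translate (R - T) k := by
  rw [sub_eq_add_neg, ← DualPoint.translate_zero_right R, ← DualPoint.translate_zero_right T,
    ← DualPoint.translate_zero, DualPoint.neg_translate, DualPoint.translate_add_translate,
    DualPoint.translate_add_translate]
  simp [sub_eq_add_neg]

theorem millerH_eq_lineQuot {p : ℕ} {P R T : E.toAffine.Point} (hP : p • P = 0) {x y : K}
    {h : E.toAffine.Nonsingular x y} (hRT : R - T = .some x y h) (i j : ℕ) (k : K) :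
    millerH p P T i j (DualPoint.inf k + DualPoint.ofBase R) =
      lineQuot (i • P) (j • P) (inl x - 2 * inl y * kEps k)
        (inl y - (3 * inl x ^ 2 + inl E.a₄) * kEps k) := by
  rw [millerH, inf_add_ofBase_sub_ofBase, hRT, vertAt, vertAt, lineQuot]
  simp only [lineAt_translate_some]
  split_ifs with hij
  · have : i • P + j • P = 0 := by rw [← add_smul, hij, hP]
    rw [this, neg_zero, ← eq_neg_of_add_eq_zero_right this]
    simp [lineVal]
  · rw [add_smul]

theorem millerPairing_eq {p : ℕ} [Fact p.Prime] [CharP K p] (hp2 : p ≠ 2) {C : List (ℕ × ℕ)}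
    {R T : E.toAffine.Point} (hR : p • R = 0) (hT : T ≠ 0) (hT2 : 2 • T = 0)
    (hC : IsAdditionChainDecomposition p C) (P : BaseTorsion E p) (k : K) :
    millerPairing C R T P k = 1 + inr (-k * slopeSum C P.1) := by
  have hP : p • P.1 = 0 := AddSubgroup.torsionBy.nsmul_iff.1 P.2
  by_cases h0 : P = 0 ∨ k = 0
  · rw [millerPairing, if_pos h0]
    rcases h0 with rfl | rfl
    · rw [ZeroMemClass.coe_zero, slopeSum_zero]
      simp
    · simp
  rw [millerPairing, if_neg h0]
  have hpT : p • T ≠ 0 := by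
    obtain ⟨m, rfl⟩ := (Fact.out : p.Prime).odd_of_ne_two hp2
    rwa [add_smul, mul_comm, mul_smul, hT2, smul_zero, zero_add, one_smul]
  have hRT : p • (R - T) ≠ 0 := by rwa [smul_sub, hR, zero_sub, neg_ne_zero]
  rcases hxy : R - T with _ | ⟨x, y, h⟩
  · exact absurd (by rw [hxy]; exact smul_zero p) hRT
  have hXY := (WeierstrassCurve.Affine.equation_iff ..).1 h.1
  simp only [a₁_of_isShortNF, a₂_of_isShortNF, a₃_of_isShortNF, zero_mul, add_zero] at hXY
  have haway : ∀ n : ℕ, IsAway (n • P.1) x := by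
    intro n
    have hn : p • n • P.1 = 0 := by rw [smul_comm, hP, smul_zero]
    rcases hnP : n • P.1 with _ | ⟨x', y', h'⟩
    · trivial
    · rintro rfl
      rw [hnP] at hn
      apply hRT
      rw [hxy]
      rcases WeierstrassCurve.Affine.Point.X_eq_iff (h₁ := h) (h₂ := h') |>.1 rfl with e | e
      · rw [e, hn]
      · rw [e, smul_neg, hn, neg_zero]
  have hU : ∀ k : K, (inl x - 2 * inl y * kEps k).fst = x := by simp
  have hU' : ∀ k : K, (inl x - 2 * inl y * kEps k).snd = -2 * y * k := by
    intro k; simp [DualPoint.fst_two]; ring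
  have hV : ∀ k : K, (inl y - (3 * inl x ^ 2 + inl E.a₄) * kEps k).fst = y := by simp
  have hV' : ∀ k : K, (inl y - (3 * inl x ^ 2 + inl E.a₄) * kEps k).snd =
      -(3 * x ^ 2 + E.a₄) * k := by
    intro k; simp [DualPoint.fst_three]; ring
  obtain ⟨S, -, hC⟩ := hC
  have hq := fun (k : K) (s : ℕ × ℕ) => dlog_lineQuot hXY (hU k) (hU' k) (hV k) (hV' k)
    (haway s.1) (haway s.2) (by rw [← add_smul]; exact haway _)
  have hi := fun (s : ℕ × ℕ) => millerH_eq_lineQuot hP hxy s.1 s.2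
  have hi0 := fun s : ℕ × ℕ => show millerH p P.1 T s.1 s.2 (DualPoint.ofBase R) =
    lineQuot (s.1 • P.1) (s.2 • P.1) (inl x - 2 * inl y * kEps 0)
      (inl y - (3 * inl x ^ 2 + inl E.a₄) * kEps 0) by
    rw [← zero_add (DualPoint.ofBase R)]
    exact millerH_eq_lineQuot hP hxy s.1 s.2 0
  simp only [hi, hi0]
  have hfst : ∀ s : ℕ × ℕ, (lineQuot (s.1 • P.1) (s.2 • P.1) (inl x - 2 * inl y * kEps k)
        (inl y - (3 * inl x ^ 2 + inl E.a₄) * kEps k) *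
      (lineQuot (s.1 • P.1) (s.2 • P.1) (inl x - 2 * inl y * kEps 0)
        (inl y - (3 * inl x ^ 2 + inl E.a₄) * kEps 0))⁻¹).fst = 1 := by
    intro s
    have h0 := (hq 0 s).1
    rw [TrivSqZeroExt.fst_mul, TrivSqZeroExt.fst_inv]
    rw [fst_lineQuot, hU, hV] at h0 ⊢
    rw [fst_lineQuot, hU, hV]
    exact mul_inv_cancel₀ h0
  rw [list_prod_eq_one_add_inr _ _ hfst,
    ← show _ = -k * slopeSum C P.1 from
      sum_dlog_lineQuot (p := p) hXY (hU k) (hU' k) (hV k) (hV' k) haway hP hC]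
  congr 3
  refine List.map_congr_left fun s _ => ?_
  rw [dlog_mul (hq k s).1 (by simpa using (hq 0 s).1), dlog_inv (hq 0 s).1, (hq 0 s).2]
  simp

end Miller

end DualCurve

namespace DualCurve

open WeierstrassCurve TrivSqZeroExt Polynomial WeierstrassCurve.Affine.CoordinateRing

section Derivation

variable {K : Type*} [Field K] (E : WeierstrassCurve K)

/-- The coordinate function `x` in the coordinate ring of `E`. -/
noncomputable def coordX : E.toAffine.CoordinateRing := mk E.toAffine (C X)

/-- The coordinate function `y` in the coordinate ring of `E`. -/
noncomputable def coordY : E.toAffine.CoordinateRing := mk E.toAffine X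

/-- The coordinate function `x` in the function field of `E`. -/
noncomputable def genX : E.toAffine.FunctionField := algebraMap _ _ (coordX E)

/-- The coordinate function `y` in the function field of `E`. -/
noncomputable def genY : E.toAffine.FunctionField := algebraMap _ _ (coordY E)

/-- The `x`-coordinate of the generic point of `E` translated by `𝒪₁`. -/
noncomputable def genDualX : E.toAffine.FunctionField[ε] := inl (genX E) + inr (-2 * genY E)

/-- The `y`-coordinate of the generic point of `E` translated by `𝒪₁`. -/
noncomputable def genDualY : E.toAffine.FunctionField[ε] :=
  inl (genY E) + inr (-(3 * genX E ^ 2 + algebraMap K _ E.a₄))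

theorem aeval_genX (q : K[X]) :
  aeval (genX E) q = algebraMap _ E.toAffine.FunctionField (mk E.toAffine (C q)) := by
  induction q using Polynomial.induction_on with
  | C a =>
    rw [aeval_C]
    rfl
  | add p q hp hq => simp only [map_add, hp, hq]
  | monomial n a h =>
    rw [map_mul, map_pow, aeval_X, aeval_C, map_mul, map_pow, map_mul, map_mul, map_pow, map_pow]
    rfl

variable [E.IsShortNF]

theorem polynomial_eq :
    E.toAffine.polynomial = X ^ 2 - C (X ^ 3 + C E.a₄ * X + C E.a₆) := by
  rw [WeierstrassCurve.Affine.polynomial]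
  simp

theorem genY_sq : genY E ^ 2 =
    genX E ^ 3 + algebraMap K _ E.a₄ * genX E + algebraMap K _ E.a₆ := by
  have h : mk E.toAffine (X ^ 2 - C (X ^ 3 + C E.a₄ * X + C E.a₆)) = 0 := by
    rw [← polynomial_eq]; exact AdjoinRoot.mk_self
  simp only [map_sub, map_add, map_mul, map_pow] at h
  have h := congrArg (algebraMap E.toAffine.CoordinateRing E.toAffine.FunctionField) h
  simp only [map_sub, map_add, map_mul, map_pow, map_zero] at h
  rw [IsScalarTower.algebraMap_apply K E.toAffine.CoordinateRing E.toAffine.FunctionField,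
    IsScalarTower.algebraMap_apply K E.toAffine.CoordinateRing E.toAffine.FunctionField]
  rw [genY, genX, coordX, coordY]
  exact (sub_eq_zero.1 h)

theorem eval₂_genDual :
    E.toAffine.polynomial.eval₂ (aeval (genDualX E) : K[X] →ₐ[K] _) (genDualY E) = 0 := by
  have h := genY_sq E
  simp only [polynomial_eq, eval₂_sub, eval₂_pow, eval₂_X, eval₂_C]
  simp only [RingHom.coe_coe, map_add, map_mul, map_pow, aeval_X, aeval_C]
  ext
  · simp [genDualX, genDualY, TrivSqZeroExt.algebraMap_eq_inl', TrivSqZeroExt.fst_pow, h]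
  · simp [genDualX, genDualY, TrivSqZeroExt.algebraMap_eq_inl', pow_succ]
    ring

/-- The ring homomorphism `f ↦ f + ε Df` on the coordinate ring, for the invariant derivation `D`
with `Dx = -2y` and `Dy = -(3x² + A)`. -/
noncomputable def coordDerivHom : E.toAffine.CoordinateRing →ₐ[K] E.toAffine.FunctionField[ε] :=
  AdjoinRoot.liftAlgHom _ (aeval (genDualX E)) (genDualY E) (eval₂_genDual E)

theorem coordDerivHom_mk_C (q : K[X]) :
    coordDerivHom E (mk E.toAffine (C q)) = aeval (genDualX E) q :=
  AdjoinRoot.lift_of (eval₂_genDual E)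

theorem coordDerivHom_coordY : coordDerivHom E (coordY E) = genDualY E :=
  AdjoinRoot.lift_root (eval₂_genDual E)

theorem fst_coordDerivHom (a : E.toAffine.CoordinateRing) :
    (coordDerivHom E a).fst = algebraMap _ _ a := by
  obtain ⟨p, q, rfl⟩ := exists_smul_basis_eq a
  have h : ∀ q : K[X], (aeval (genDualX E) q).fst = aeval (genX E) q := fun q => by
    rw [← fstHom_apply K, ← aeval_algHom_apply]
    simp [genDualX]
  rw [Affine.CoordinateRing.smul, Affine.CoordinateRing.smul, mul_one, map_add, map_mul,
    map_add, map_mul, coordDerivHom_mk_C,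
    coordDerivHom_mk_C, ← coordY, coordDerivHom_coordY, TrivSqZeroExt.fst_add,
    TrivSqZeroExt.fst_mul, h, h, aeval_genX, aeval_genX]
  simp [genDualY, genY]

theorem isUnit_coordDerivHom (a : nonZeroDivisors E.toAffine.CoordinateRing) :
    IsUnit (coordDerivHom E a) := by
  rw [TrivSqZeroExt.isUnit_iff_isUnit_fst, fst_coordDerivHom, isUnit_iff_ne_zero]
  exact IsFractionRing.to_map_ne_zero_of_mem_nonZeroDivisors a.2

/-- The ring homomorphism `f ↦ f + ε Df` on the function field, for the invariant derivation `D`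
with `Dx = -2y` and `Dy = -(3x² + A)`. -/
noncomputable def derivHom : E.toAffine.FunctionField →ₐ[K] E.toAffine.FunctionField[ε] :=
  IsLocalization.liftAlgHom (isUnit_coordDerivHom E)

theorem derivHom_algebraMap (a : E.toAffine.CoordinateRing) :
    derivHom E (algebraMap _ _ a) = coordDerivHom E a :=
  IsLocalization.lift_eq (isUnit_coordDerivHom E) a

theorem fst_derivHom (f : E.toAffine.FunctionField) : (derivHom E f).fst = f := by
  have h : ((fstHom K E.toAffine.FunctionField E.toAffine.FunctionField).comp
      (derivHom E)).toRingHom = RingHom.id E.toAffine.FunctionField :=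
    IsLocalization.ringHom_ext (nonZeroDivisors E.toAffine.CoordinateRing) <| RingHom.ext fun a =>
      (congrArg TrivSqZeroExt.fst (derivHom_algebraMap E a)).trans (fst_coordDerivHom E a)
  exact RingHom.congr_fun h f

theorem derivHom_genX : derivHom E (genX E) = genDualX E := by
  rw [genX, derivHom_algebraMap, coordX, coordDerivHom_mk_C, aeval_X]

theorem derivHom_genY : derivHom E (genY E) = genDualY E := by
  rw [genY, derivHom_algebraMap, coordDerivHom_coordY]

theorem derivHom_inv (f : E.toAffine.FunctionField) : derivHom E f⁻¹ = (derivHom E f)⁻¹ := by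
  by_cases hf : f = 0
  · simp [hf]
  · have h : (derivHom E f).fst ≠ 0 := by rwa [fst_derivHom]
    calc _ = derivHom E f⁻¹ * (derivHom E f * (derivHom E f)⁻¹) := by
          rw [TrivSqZeroExt.mul_inv_cancel h, mul_one]
      _ = (derivHom E f)⁻¹ := by rw [← mul_assoc, ← map_mul, inv_mul_cancel₀ hf, map_one, one_mul]

end Derivation

end DualCurve

namespace DualCurve

open WeierstrassCurve TrivSqZeroExt Polynomial WeierstrassCurve.Affine.CoordinateRing
open scoped nonZeroDivisors

section Ideals

variable {K : Type*} [Field K] (E : WeierstrassCurve K)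

theorem genX_sub_algebraMap (x : K) :
    genX E - algebraMap K _ x = algebraMap E.toAffine.CoordinateRing _ (XClass E.toAffine x) := by
  rw [XClass, map_sub, map_sub, map_sub, genX, coordX]
  rfl

variable {E}

theorem isAway_genX (P : E.toAffine.Point) : IsAway P (genX E) := by
  rcases P with _ | ⟨x, y, h⟩
  · trivial
  · intro he
    have := genX_sub_algebraMap E x
    rw [he, sub_self, eq_comm, map_eq_zero_iff _ (IsFractionRing.injective _ _)] at this
    exact XClass_ne_zero x this

/-- The invertible fractional ideal of functions on the affine curve that vanish at `P`. -/
noncomputable def pointIdeal :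
    E.toAffine.Point → (FractionalIdeal E.toAffine.CoordinateRing⁰ E.toAffine.FunctionField)ˣ
  | .zero => 1
  | .some _ _ h => XYIdeal' (W := E.toAffine) h

/-- The principal fractional ideal generated by a function. -/
noncomputable abbrev principal (f : E.toAffine.FunctionField) :
    FractionalIdeal E.toAffine.CoordinateRing⁰ E.toAffine.FunctionField :=
  FractionalIdeal.spanSingleton _ f

theorem principal_mul (f g : E.toAffine.FunctionField) :
    principal (f * g) = principal f * principal g :=
  (FractionalIdeal.spanSingleton_mul_spanSingleton ..).symm

theorem coe_pointIdeal_some {x y : K} (h : E.toAffine.Nonsingular x y) :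
    (pointIdeal (.some x y h) : FractionalIdeal E.toAffine.CoordinateRing⁰ E.toAffine.FunctionField)
      = XYIdeal E.toAffine x (C y) := rfl

theorem principal_algebraMap (a : E.toAffine.CoordinateRing) :
    principal (algebraMap _ E.toAffine.FunctionField a) = (Ideal.span {a} : Ideal _) :=
  (FractionalIdeal.coeIdeal_span_singleton a).symm

theorem principal_genX_sub {x y : K} (h : E.toAffine.Nonsingular x y) :
    principal (genX E - algebraMap K _ x) =
      ((pointIdeal (.some x y h) * pointIdeal (-.some x y h) : (FractionalIdeal _ _)ˣ) :
        FractionalIdeal _ _) := by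
  rw [genX_sub_algebraMap, principal_algebraMap, WeierstrassCurve.Affine.Point.neg_some,
    Units.val_mul, coe_pointIdeal_some, coe_pointIdeal_some, ← FractionalIdeal.coeIdeal_mul,
    mul_comm, XYIdeal_neg_mul h]
  rfl

variable [DecidableEq K] [E.IsShortNF]

theorem principal_lineVal (P Q : E.toAffine.Point) :
    principal (lineVal P Q (genX E) (genY E)) =
      ((pointIdeal P * pointIdeal Q * pointIdeal (-(P + Q)) : (FractionalIdeal _ _)ˣ) :
        FractionalIdeal _ _) := by
  have h0 : pointIdeal (0 : E.toAffine.Point) = 1 := rfl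
  rcases P with _ | ⟨x₁, y₁, h₁⟩
  · rw [← WeierstrassCurve.Affine.Point.zero_def, zero_add, h0, one_mul]
    rcases Q with _ | ⟨x₂, y₂, h₂⟩
    · rw [← WeierstrassCurve.Affine.Point.zero_def, neg_zero, h0, one_mul]
      exact FractionalIdeal.spanSingleton_one
    · exact principal_genX_sub h₂
  rcases Q with _ | ⟨x₂, y₂, h₂⟩
  · rw [← WeierstrassCurve.Affine.Point.zero_def, add_zero, h0, mul_one]
    exact principal_genX_sub h₁
  by_cases h : x₁ = x₂ ∧ y₁ = E.toAffine.negY x₂ y₂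
  · rw [WeierstrassCurve.Affine.Point.add_of_Y_eq h.1 h.2, neg_zero, h0, mul_one]
    have h' := h
    rw [DualPoint.negY_eq] at h'
    simp only [lineVal, if_pos h']
    rw [principal_genX_sub h₁, WeierstrassCurve.Affine.Point.neg_some]
    congr 3
    obtain ⟨rfl, rfl⟩ := h'
    simp
  · have h' := h
    rw [DualPoint.negY_eq] at h'
    have hv : lineVal (.some x₁ y₁ h₁) (.some x₂ y₂ h₂) (genX E) (genY E) =
        algebraMap E.toAffine.CoordinateRing _ (YClass E.toAffine
          (WeierstrassCurve.Affine.linePolynomial x₁ y₁ (E.toAffine.slope x₁ x₂ y₁ y₂))) := by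
      simp only [lineVal, if_neg h']
      rw [YClass, WeierstrassCurve.Affine.linePolynomial, genX_sub_algebraMap, genY, coordY]
      simp only [map_sub, map_add, map_mul, XClass]
      rw [sub_sub, add_comm]
      rfl
    have key := XYIdeal_mul_XYIdeal h₁.1 h₂.1 h
    have h₃ := WeierstrassCurve.Affine.nonsingular_add h₁ h₂ h
    have hX := XYIdeal_neg_mul h₃
    rw [WeierstrassCurve.Affine.Point.add_some h, WeierstrassCurve.Affine.Point.neg_some, hv,
      principal_algebraMap, ← Units.mul_left_inj (pointIdeal (.some _ _ h₃))]
    simp only [Units.val_mul, coe_pointIdeal_some, ← FractionalIdeal.coeIdeal_mul]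
    rw [mul_assoc, hX, mul_comm _ (XIdeal _ _), key, YIdeal]

/-- The quotient of the line through `P` and `Q` by the vertical line through `P + Q`, in the function
field. -/
noncomputable def lineQuotFun (P Q : E.toAffine.Point) : E.toAffine.FunctionField :=
  lineVal P Q (genX E) (genY E) * (lineVal (P + Q) (-(P + Q)) (genX E) (genY E))⁻¹

theorem principal_lineQuotFun (P Q : E.toAffine.Point) :
    principal (lineQuotFun P Q) = ((pointIdeal P * pointIdeal Q * (pointIdeal (P + Q))⁻¹ :
      (FractionalIdeal _ _)ˣ) : FractionalIdeal _ _) := by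
  have h0 : pointIdeal (0 : E.toAffine.Point) = 1 := rfl
  have h₁ := principal_lineVal P Q
  have h₂ := principal_lineVal (P + Q) (-(P + Q))
  rw [add_neg_cancel, neg_zero, h0, mul_one] at h₂
  have hne : lineVal (P + Q) (-(P + Q)) (genX E) (genY E) ≠ 0 := by
    intro h
    rw [h, principal, FractionalIdeal.spanSingleton_zero] at h₂
    exact Units.ne_zero _ h₂.symm
  rw [← Units.mul_left_inj (pointIdeal (P + Q) * pointIdeal (-(P + Q))), ← h₂, ← principal_mul,
    lineQuotFun, inv_mul_cancel_right₀ hne, h₁, h₂, ← Units.val_mul]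
  congr 1
  group

theorem derivHom_lineQuotFun (P Q : E.toAffine.Point) :
    derivHom E (lineQuotFun P Q) = lineQuot P Q (genDualX E) (genDualY E) := by
  rw [lineQuotFun, lineQuot, map_mul, derivHom_inv, map_lineVal, map_lineVal, derivHom_genX,
    derivHom_genY]

/-- Miller's function for `P` and the decomposition `C`. -/
noncomputable def millerFun (C : List (ℕ × ℕ)) (P : E.toAffine.Point) : E.toAffine.FunctionField :=
  (C.map fun s => lineQuotFun (s.1 • P) (s.2 • P)).prod

theorem principal_millerFun_eq {S : Finset ℕ} {M : Multiset ℕ} {C : List (ℕ × ℕ)}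
    (hC : Decomposes S M C) (P : E.toAffine.Point) :
    principal (millerFun C P) = ((pointIdeal P ^ M.sum *
      ((M.map fun n => pointIdeal (n • P)).prod)⁻¹ : (FractionalIdeal _ _)ˣ) :
        FractionalIdeal _ _) := by
  induction hC with
  | ones m => simp [millerFun]
  | @step i j M C hi hj hij h ih =>
    have := principal_lineQuotFun (i • P) (j • P)
    rw [millerFun] at ih ⊢
    rw [List.map_cons, List.prod_cons, principal_mul, this, ih, ← Units.val_mul]
    have hG : ∀ {G : Type _} [AddCommGroup G] (a b c d z : G),
        a + b - c + (d - (a + (b + z))) = d - (c + z) := by intros; abel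
    simp only [Multiset.sum_cons, Multiset.map_cons, Multiset.prod_cons, add_smul, ← div_eq_mul_inv,
      ← add_assoc]
    exact congrArg Units.val (hG (G := Additive (FractionalIdeal E.toAffine.CoordinateRing⁰
      E.toAffine.FunctionField)ˣ) ..)

theorem principal_millerFun {p : ℕ} {S : Finset ℕ} {C : List (ℕ × ℕ)}
    (hC : Decomposes S {p} C) {P : E.toAffine.Point} (hP : p • P = 0) :
    principal (millerFun C P) = ((pointIdeal P ^ p : (FractionalIdeal _ _)ˣ) :
        FractionalIdeal _ _) := by
  rw [principal_millerFun_eq hC]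
  simp [hP, show pointIdeal (0 : E.toAffine.Point) = 1 from rfl]

theorem dlog_derivHom_millerFun {p : ℕ} [CharP K p] {S : Finset ℕ} {C : List (ℕ × ℕ)}
    (hC : Decomposes S {p} C) {P : E.toAffine.Point} (hP : p • P = 0) :
    dlog (derivHom E (millerFun C P)) = -algebraMap K _ (slopeSum C P) := by
  have : CharP E.toAffine.FunctionField p :=
    charP_of_injective_algebraMap (algebraMap K E.toAffine.FunctionField).injective p
  have hX : (genDualX E).fst = genX E := by simp [genDualX]
  have hX' : (genDualX E).snd = -2 * genY E * 1 := by simp [genDualX]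
  have hY : (genDualY E).fst = genY E := by simp [genDualY]
  have hY' : (genDualY E).snd = -(3 * genX E ^ 2 + algebraMap K _ E.a₄) * 1 := by
    simp [genDualY]
  rw [millerFun, map_list_prod, List.map_map,
    (dlog_list_prod C _ fun s _ => ?_).2]
  · simp only [Function.comp_apply, derivHom_lineQuotFun]
    rw [sum_dlog_lineQuot (p := p) (genY_sq E) hX hX' hY hY' (fun n => isAway_genX _) hP hC]
    ring
  · rw [Function.comp_apply, derivHom_lineQuotFun]
    exact (dlog_lineQuot (genY_sq E) hX hX' hY hY' (isAway_genX _) (isAway_genX _)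
      (isAway_genX _)).1

end Ideals

end DualCurve

namespace DualCurve

open WeierstrassCurve TrivSqZeroExt Polynomial WeierstrassCurve.Affine.CoordinateRing
open scoped nonZeroDivisors

section Additivity

variable {K : Type*} [Field K] {E : WeierstrassCurve K}

theorem exists_algebraMap_eq_of_isUnit {u : E.toAffine.CoordinateRing} (hu : IsUnit u) :
    ∃ c : K, u = algebraMap K _ c := by
  obtain ⟨p, q, rfl⟩ := exists_smul_basis_eq u
  have h := hu.map (Algebra.norm K[X])
  have hd := degree_eq_zero_of_isUnit h
  rw [degree_norm_smul_basis] at hd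
  have hq : q = 0 := by
    by_contra hq
    have := le_max_right (2 • p.degree) (2 • q.degree + 3)
    rw [hd, degree_eq_natDegree hq] at this
    norm_cast at this
  have hp : p.degree ≤ 0 := by
    by_cases hp : p = 0
    · simp [hp]
    have := le_max_left (2 • p.degree) (2 • q.degree + 3)
    rw [hd] at this
    rw [degree_eq_natDegree hp] at this ⊢
    rw [two_nsmul] at this
    norm_cast at this ⊢
    omega
  rw [eq_C_of_degree_le_zero hp, hq, zero_smul, add_zero, Affine.CoordinateRing.smul, mul_one]
  exact ⟨_, rfl⟩

theorem principal_pow (f : E.toAffine.FunctionField) (n : ℕ) :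
    principal (f ^ n) = principal f ^ n :=
  (FractionalIdeal.spanSingleton_pow ..).symm

theorem ne_zero_of_principal_eq_unit {f : E.toAffine.FunctionField}
    {I : (FractionalIdeal E.toAffine.CoordinateRing⁰ E.toAffine.FunctionField)ˣ}
    (h : principal f = I) : f ≠ 0 := by
  rintro rfl
  rw [principal, FractionalIdeal.spanSingleton_zero] at h
  exact I.ne_zero h.symm

variable [E.IsShortNF]

theorem dlog_derivHom_mul {f g : E.toAffine.FunctionField} (hf : f ≠ 0) (hg : g ≠ 0) :
    dlog (derivHom E (f * g)) = dlog (derivHom E f) + dlog (derivHom E g) := by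
  rw [map_mul, dlog_mul] <;> rwa [fst_derivHom]

theorem dlog_derivHom_pow {f : E.toAffine.FunctionField} (hf : f ≠ 0) (n : ℕ) :
    dlog (derivHom E (f ^ n)) = n * dlog (derivHom E f) := by
  rw [map_pow, dlog_pow]
  rwa [fst_derivHom]

theorem dlog_derivHom_eq_of_principal_eq {f g : E.toAffine.FunctionField} (hf : f ≠ 0)
    (h : principal f = principal g) : dlog (derivHom E f) = dlog (derivHom E g) := by
  obtain ⟨z, rfl⟩ := FractionalIdeal.spanSingleton_eq_spanSingleton.1 h
  obtain ⟨c, hc⟩ := exists_algebraMap_eq_of_isUnit z.isUnit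
  have hz : (algebraMap E.toAffine.CoordinateRing E.toAffine.FunctionField z) ≠ 0 :=
    (z.isUnit.map _).ne_zero
  rw [Units.smul_def, Algebra.smul_def, dlog_derivHom_mul hz hf, derivHom_algebraMap, hc,
    AlgHom.commutes, TrivSqZeroExt.algebraMap_eq_inl']
  simp [dlog]

variable [DecidableEq K]

theorem slopeSum_add {p : ℕ} [CharP K p] {S : Finset ℕ} {C : List (ℕ × ℕ)}
    (hC : Decomposes S {p} C) {P Q : E.toAffine.Point} (hP : p • P = 0) (hQ : p • Q = 0) :
    slopeSum C (P + Q) = slopeSum C P + slopeSum C Q := by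
  have : CharP E.toAffine.FunctionField p :=
    charP_of_injective_algebraMap (algebraMap K E.toAffine.FunctionField).injective p
  have hPQ : p • (P + Q) = 0 := by rw [smul_add, hP, hQ, add_zero]
  have pP := principal_millerFun hC hP
  have pQ := principal_millerFun hC hQ
  have pPQ := principal_millerFun hC hPQ
  have pq := principal_lineQuotFun P Q
  have nP := ne_zero_of_principal_eq_unit pP
  have nQ := ne_zero_of_principal_eq_unit pQ
  have nPQ := ne_zero_of_principal_eq_unit pPQ
  have nq := ne_zero_of_principal_eq_unit pq
  have h : principal (millerFun C (P + Q) * lineQuotFun P Q ^ p) =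
      principal (millerFun C P * millerFun C Q) := by
    rw [principal_mul, principal_mul, pP, pQ, pPQ, principal_pow, pq,
      ← Units.val_pow_eq_pow_val, ← Units.val_mul, ← Units.val_mul, ← mul_pow, ← mul_pow,
      mul_comm (pointIdeal (P + Q)), inv_mul_cancel_right]
  have h := dlog_derivHom_eq_of_principal_eq (mul_ne_zero nPQ (pow_ne_zero p nq)) h
  rw [dlog_derivHom_mul nPQ (pow_ne_zero p nq), dlog_derivHom_mul nP nQ, dlog_derivHom_pow nq,
    CharP.cast_eq_zero, zero_mul, add_zero, dlog_derivHom_millerFun hC hP,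
    dlog_derivHom_millerFun hC hQ, dlog_derivHom_millerFun hC hPQ, ← neg_add, neg_inj,
    ← map_add] at h
  exact (algebraMap K E.toAffine.FunctionField).injective h

end Additivity

end DualCurve

namespace DualCurve

open WeierstrassCurve TrivSqZeroExt Polynomial WeierstrassCurve.Affine.CoordinateRing
open scoped nonZeroDivisors

section Nonvanishing

variable {K : Type*} [Field K] {E : WeierstrassCurve K}

theorem exists_eq_pow_of_derivative_eq_zero [IsAlgClosed K] {p : ℕ} [Fact p.Prime] [CharP K p]
    {f : K[X]} (h : derivative f = 0) : ∃ g : K[X], f = g ^ p := by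
  rw [← expand_contract p h (Fact.out : p.Prime).ne_zero]
  exact ⟨_, polynomial_expand_eq ..⟩

variable (E) in
/-- The right side of `y² = x³ + Ax + B`. -/
noncomputable def cubic : K[X] := X ^ 3 + C E.a₄ * X + C E.a₆

theorem derivative_cubic : derivative (cubic E) = 3 * X ^ 2 + C E.a₄ := by
  simp only [cubic, derivative_add, derivative_mul, derivative_X_pow, derivative_C, derivative_X,
    map_natCast]
  push_cast
  ring

variable [E.IsShortNF]

theorem squarefree_cubic [E.IsElliptic] : Squarefree (cubic E) := by
  apply Polynomial.Separable.squarefree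
  have hΔ := E.isUnit_Δ.ne_zero
  rw [E.Δ_of_isShortNF] at hΔ
  have hD : 4 * E.a₄ ^ 3 + 27 * E.a₆ ^ 2 ≠ 0 := fun h => hΔ (by rw [h, mul_zero])
  refine ⟨C (4 * E.a₄ ^ 3 + 27 * E.a₆ ^ 2)⁻¹ * -(18 * C E.a₄ * X - 27 * C E.a₆),
    C (4 * E.a₄ ^ 3 + 27 * E.a₆ ^ 2)⁻¹ * (6 * C E.a₄ * X ^ 2 - 9 * C E.a₆ * X + 4 * C E.a₄ ^ 2), ?_⟩
  have hc : C (4 * E.a₄ ^ 3 + 27 * E.a₆ ^ 2)⁻¹ * (4 * C E.a₄ ^ 3 + 27 * C E.a₆ ^ 2) = 1 := by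
    rw [← C_1, ← inv_mul_cancel₀ hD, C_mul]
    simp only [map_add, map_mul, map_pow, map_ofNat]
  rw [derivative_cubic, cubic]
  linear_combination hc

/-- A function in the kernel of the invariant derivation is a `p`-th power. -/
theorem exists_eq_pow_of_snd_coordDerivHom_eq_zero [IsAlgClosed K] [E.IsElliptic] {p : ℕ}
    [Fact p.Prime] [CharP K p] (hp2 : p ≠ 2) {a : E.toAffine.CoordinateRing}
    (h : (coordDerivHom E a).snd = 0) : ∃ g, a = g ^ p := by
  have h2 : (2 : K) ≠ 0 := DualPoint.two_ne_zero_of_isElliptic E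
  have hY : mk E.toAffine X ^ 2 = mk E.toAffine (C (cubic E)) := by
    have h : mk E.toAffine (X ^ 2 - C (X ^ 3 + C E.a₄ * X + C E.a₆)) = 0 := by
      rw [← polynomial_eq]; exact AdjoinRoot.mk_self
    rw [map_sub, map_pow] at h
    exact sub_eq_zero.1 h
  obtain ⟨u, v, rfl⟩ := exists_smul_basis_eq a
  have haeval : ∀ q : K[X], aeval (genDualX E) q = inl (aeval (genX E) q) +
      inr (aeval (genX E) (derivative q) * (-2 * genY E)) := by
    intro q
    have hinl : ∀ q : K[X], aeval (inl (genX E) : E.toAffine.FunctionField[ε]) q =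
        inl (aeval (genX E) q) := fun q => aeval_algHom_apply (inlAlgHom K _ _) (genX E) q
    rw [genDualX, aeval_add_of_sq_eq_zero _ _ _ (by rw [pow_two, inr_mul_inr]), hinl, hinl,
      inl_mul_inr, smul_eq_mul]
  have key : (-(2 * derivative v * cubic E + v * derivative (cubic E))) • 1 +
      (-(2 * derivative u)) • mk E.toAffine X = 0 := by
    apply IsFractionRing.injective E.toAffine.CoordinateRing E.toAffine.FunctionField
    have hsq := congrArg (algebraMap E.toAffine.CoordinateRing E.toAffine.FunctionField) hY
    have hc := congrArg (aeval (genX E)) (derivative_cubic (E := E))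
    rw [map_pow, ← aeval_genX] at hsq
    rw [map_zero, ← h]
    simp only [Affine.CoordinateRing.smul, map_add, map_mul, mul_one, coordDerivHom_mk_C,
      ← aeval_genX]
    rw [← coordY] at hsq ⊢
    rw [coordDerivHom_coordY, haeval, haeval, genDualY]
    simp only [map_neg, map_add, map_mul, map_ofNat, map_pow, aeval_X, aeval_C] at hc ⊢
    rw [← genY] at hsq ⊢
    simp
    linear_combination (2 * aeval (genX E) (derivative v)) * hsq - aeval (genX E) v * hc
  obtain ⟨k₁, k₂⟩ := smul_basis_eq_zero key
  have hC2 : (2 : K[X]) ≠ 0 := by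
    rw [← map_ofNat C]; simpa using h2
  obtain ⟨t, rfl⟩ := exists_eq_pow_of_derivative_eq_zero (p := p) (f := u) (by
    simpa [hC2] using k₂)
  obtain ⟨m, hm⟩ := (Fact.out : p.Prime).odd_of_ne_two hp2
  have hmp : (2 * m + 1 : K) = 0 := by exact_mod_cast hm ▸ CharP.cast_eq_zero K p
  have hmp' : (2 * m + 1 : K[X]) = 0 := by
    rw [← map_natCast C, ← map_ofNat C, ← C_1, ← C_mul, ← C_add, hmp, C_0]
  obtain ⟨w, hw⟩ := exists_eq_pow_of_derivative_eq_zero (p := p) (f := v * cubic E ^ (m + 1)) (by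
    apply mul_left_cancel₀ hC2
    rw [derivative_mul, derivative_pow]
    simp only [Nat.cast_add, Nat.cast_one, map_add, map_one, map_natCast, Nat.add_sub_cancel]
    linear_combination (v * cubic E ^ m * derivative (cubic E)) * hmp' - cubic E ^ m * k₁)
  have hdvd : cubic E ∣ w := by
    rw [← squarefree_cubic.dvd_pow_iff_dvd (Fact.out : p.Prime).ne_zero, ← hw, pow_succ]
    exact ⟨v * cubic E ^ m, by ring⟩
  obtain ⟨z, rfl⟩ := hdvd
  have hv : v = cubic E ^ m * z ^ p := by
    apply mul_right_cancel₀ (pow_ne_zero (m + 1) (squarefree_cubic (E := E)).ne_zero)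
    have hcp : cubic E ^ p = cubic E ^ m * cubic E ^ (m + 1) := by
      rw [← pow_add]; congr 1; omega
    rw [hw, mul_pow, hcp]
    ring
  have : CharP E.toAffine.CoordinateRing p :=
    charP_of_injective_algebraMap (algebraMap K E.toAffine.CoordinateRing).injective p
  refine ⟨mk E.toAffine (C t) + mk E.toAffine (C z) * mk E.toAffine X, ?_⟩
  have hYp : mk E.toAffine X ^ p = mk E.toAffine (C (cubic E)) ^ m * mk E.toAffine X := by
    rw [hm, pow_succ, pow_mul, hY]
  rw [add_pow_char, mul_pow, hYp, hv]
  simp only [Affine.CoordinateRing.smul, map_mul, map_pow]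
  ring

omit [E.IsShortNF] in
theorem eq_zero_of_principal_eq_pow [DecidableEq K] {P : E.toAffine.Point} {p : ℕ} (hp : p ≠ 0)
    {g : E.toAffine.CoordinateRing}
    (h : principal (algebraMap _ E.toAffine.FunctionField (g ^ p)) =
      ((pointIdeal P ^ p : (FractionalIdeal _ _)ˣ) : FractionalIdeal _ _)) : P = 0 := by
  rcases P with _ | ⟨x, y, hxy⟩
  · rfl
  have hI : (XYIdeal E.toAffine x (C y)).IsPrime := by
    have := (quotientXYIdealEquiv hxy.1).toRingEquiv
    rw [← Ideal.Quotient.isDomain_iff_prime]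
    exact this.toMulEquiv.isDomain _
  have hg : g ∈ XYIdeal E.toAffine x (C y) := by
    rw [principal_algebraMap, Units.val_pow_eq_pow_val, coe_pointIdeal_some,
      ← FractionalIdeal.coeIdeal_pow, FractionalIdeal.coeIdeal_inj] at h
    exact hI.mem_of_pow_mem p (Ideal.pow_le_self hp (h ▸ Ideal.mem_span_singleton_self _))
  have hle : principal (algebraMap _ E.toAffine.FunctionField g) ≤ pointIdeal (.some x y hxy) := by
    rw [principal_algebraMap, coe_pointIdeal_some, FractionalIdeal.coeIdeal_le_coeIdeal]
    exact (Ideal.span_singleton_le_iff_mem _).2 hg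
  have hge : pointIdeal (.some x y hxy) ≤ principal (algebraMap _ E.toAffine.FunctionField g) := by
    obtain ⟨n, rfl⟩ := Nat.exists_eq_succ_of_ne_zero hp
    rw [map_pow, principal_pow, Units.val_pow_eq_pow_val, pow_succ', pow_succ'] at h
    have hpow : principal (algebraMap _ E.toAffine.FunctionField g) ^ n ≤
        (pointIdeal (.some x y hxy) : FractionalIdeal E.toAffine.CoordinateRing⁰
          E.toAffine.FunctionField) ^ n := pow_le_pow_left' hle n
    have hmul := mul_le_mul_left (h.ge.trans (mul_le_mul_right hpow _))
      (((pointIdeal (.some x y hxy) ^ n)⁻¹ : (FractionalIdeal _ _)ˣ) : FractionalIdeal _ _)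
    rwa [← Units.val_pow_eq_pow_val, Units.mul_inv_cancel_right, Units.mul_inv_cancel_right] at hmul
  have heq := hle.antisymm hge
  rw [← WeierstrassCurve.Affine.Point.toClass_eq_zero, WeierstrassCurve.Affine.Point.toClass_some]
  refine (ClassGroup.mk_eq_one_of_coe_ideal (coe_pointIdeal_some hxy)).2 ⟨g, ?_, ?_⟩
  · rintro rfl
    rw [map_zero, principal, FractionalIdeal.spanSingleton_zero] at heq
    exact Units.ne_zero _ heq.symm
  · rwa [principal_algebraMap, coe_pointIdeal_some, FractionalIdeal.coeIdeal_inj, eq_comm] at heq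

theorem slopeSum_ne_zero [IsAlgClosed K] [DecidableEq K] [E.IsElliptic] {p : ℕ}
    [Fact p.Prime] [CharP K p] (hp2 : p ≠ 2) {S : Finset ℕ} {C : List (ℕ × ℕ)}
    (hC : Decomposes S {p} C) {P : E.toAffine.Point} (hP : p • P = 0) (hP0 : P ≠ 0) :
    slopeSum C P ≠ 0 := by
  intro h
  have hd := dlog_derivHom_millerFun hC hP
  have hpr := principal_millerFun hC hP
  have h0 := ne_zero_of_principal_eq_unit hpr
  obtain ⟨a, ha⟩ : ∃ a, algebraMap E.toAffine.CoordinateRing _ a = millerFun C P := by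
    have hle : (pointIdeal P : FractionalIdeal E.toAffine.CoordinateRing⁰ E.toAffine.FunctionField)
        ≤ 1 := by
      rcases P with _ | ⟨x, y, hxy⟩
      · exact le_rfl
      · exact FractionalIdeal.coeIdeal_le_one
    rw [← FractionalIdeal.mem_one_iff E.toAffine.CoordinateRing⁰]
    rw [Units.val_pow_eq_pow_val] at hpr
    exact hpr.le.trans (pow_le_one' hle p) (FractionalIdeal.mem_spanSingleton_self _ _)
  rw [h, map_zero, neg_zero, ← ha, derivHom_algebraMap, dlog, fst_coordDerivHom, ha,
    div_eq_zero_iff, or_iff_left h0] at hd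
  obtain ⟨g, rfl⟩ := exists_eq_pow_of_snd_coordDerivHom_eq_zero hp2 hd
  rw [← ha] at hpr
  exact hP0 (eq_zero_of_principal_eq_pow (Fact.out : p.Prime).ne_zero hpr)

end Nonvanishing

end DualCurve

namespace DualCurve

open WeierstrassCurve TrivSqZeroExt

section Extension

variable {K : Type*} [Field K]

theorem one_add_inr_mul (a b : K) :
    (1 + inr a : K[ε]) * (1 + inr b) = 1 + inr (a + b) := by
  ext <;> simp [add_comm]

theorem one_add_inr_pow (a : K) (n : ℕ) : (1 + inr a : K[ε]) ^ n = 1 + inr (n * a) := by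
  induction n with
  | zero => simp
  | succ n ih => rw [pow_succ, ih, one_add_inr_mul]; push_cast; ring_nf

/-- The `p`-th root of unity `1 + aε` in `K[ε]`. -/
noncomputable def oneAddEps (p : ℕ) [Fact p.Prime] [CharP K p] (a : K) : rootsOfUnity p K[ε] :=
  rootsOfUnity.mkOfPowEq (1 + inr a) (by
    rw [one_add_inr_pow, CharP.cast_eq_zero, zero_mul, inr_zero, add_zero])

theorem coe_oneAddEps (p : ℕ) [Fact p.Prime] [CharP K p] (a : K) :
    ((oneAddEps p a : K[ε]ˣ) : K[ε]) = 1 + inr a := rfl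

theorem rootsOfUnity_ext {p : ℕ} {x y : rootsOfUnity p K[ε]}
    (h : ((x : K[ε]ˣ) : K[ε]) = ((y : K[ε]ˣ) : K[ε])) : x = y :=
  Subtype.ext (Units.ext h)

theorem oneAddEps_add (p : ℕ) [Fact p.Prime] [CharP K p] (a b : K) :
    oneAddEps p (a + b) = oneAddEps p a * oneAddEps p b :=
  rootsOfUnity_ext (one_add_inr_mul a b).symm

theorem oneAddEps_eq_one_iff (p : ℕ) [Fact p.Prime] [CharP K p] {a : K} :
    oneAddEps p a = 1 ↔ a = 0 := by
  constructor
  · intro h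
    have := congrArg (fun x : rootsOfUnity p K[ε] => ((x : K[ε]ˣ) : K[ε]).snd) h
    simpa [coe_oneAddEps] using this
  · rintro rfl
    exact rootsOfUnity_ext (by simp [coe_oneAddEps])

variable [DecidableEq K] {E : WeierstrassCurve K} [E.IsShortNF] [E.IsElliptic]

omit [E.IsElliptic] in
theorem translate_eq_zero_iff {P : E.toAffine.Point} {k : K} :
    DualPoint.translate P k = 0 ↔ P = 0 ∧ k = 0 := by
  constructor
  · intro h
    rcases P with _ | ⟨x, y, hxy⟩
    · rw [← Affine.Point.zero_def, DualPoint.translate_zero] at h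
      exact ⟨rfl, DualPoint.inf.inj h⟩
    · change DualPoint.affine _ _ _ = DualPoint.inf 0 at h
      cases h
  · rintro ⟨rfl, rfl⟩
    exact DualPoint.translate_zero 0

theorem translate_injective {P Q : E.toAffine.Point} {j k : K}
    (h : DualPoint.translate P j = DualPoint.translate Q k) : P = Q ∧ j = k := by
  rw [← sub_eq_zero, sub_eq_add_neg, DualPoint.neg_translate, DualPoint.translate_add_translate,
    translate_eq_zero_iff, ← sub_eq_add_neg, ← sub_eq_add_neg, sub_eq_zero, sub_eq_zero] at h
  exact h

theorem nsmul_translate (n : ℕ) (P : E.toAffine.Point) (k : K) :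
    n • DualPoint.translate P k = DualPoint.translate (n • P) (n * k) := by
  induction n with
  | zero => rw [zero_smul, zero_smul, Nat.cast_zero, zero_mul]
            exact (translate_eq_zero_iff.2 ⟨rfl, rfl⟩).symm
  | succ n ih =>
    rw [succ_nsmul, ih, DualPoint.translate_add_translate, succ_nsmul]
    push_cast
    rw [add_mul, one_mul]

theorem coe_baseTorsion_add_thetaTorsion {p : ℕ} [CharP K p] (P : BaseTorsion E p) (k : K) :
    ((baseTorsion P + thetaTorsion E p k : DualTorsion E p) : DualPoint E) =
      DualPoint.translate P.1 k := rfl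

variable (E) in
/-- The decomposition `Ẽ[p] = E[p] ⊕ Θ`. -/
theorem existsUnique_base_add_theta {p : ℕ} [CharP K p] (P : DualTorsion E p) :
    ∃! Q : BaseTorsion E p × K, P = baseTorsion Q.1 + thetaTorsion E p Q.2 := by
  obtain ⟨Q, k, hQ⟩ := DualPoint.translate_surjective P.1
  have hp : p • P.1 = 0 := AddSubgroup.torsionBy.nsmul_iff.1 P.2
  rw [hQ, nsmul_translate, translate_eq_zero_iff] at hp
  refine ⟨(⟨Q, AddSubgroup.torsionBy.nsmul_iff.2 hp.1⟩, k), Subtype.ext hQ, ?_⟩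
  rintro ⟨Q', k'⟩ h'
  have h := congrArg Subtype.val h'
  rw [coe_baseTorsion_add_thetaTorsion, hQ] at h
  obtain ⟨h₁, h₂⟩ := translate_injective h
  exact Prod.ext (Subtype.ext h₁.symm) h₂.symm

variable (E) in
/-- The components of a point of `Ẽ[p]` in `E[p] ⊕ Θ`. -/
noncomputable def components {p : ℕ} [CharP K p] (P : DualTorsion E p) : BaseTorsion E p × K :=
  (existsUnique_base_add_theta E P).choose

theorem base_add_theta_components {p : ℕ} [CharP K p] (P : DualTorsion E p) :
    baseTorsion (components E P).1 + thetaTorsion E p (components E P).2 = P :=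
  (existsUnique_base_add_theta E P).choose_spec.1.symm

theorem components_base_add_theta {p : ℕ} [CharP K p] (P : BaseTorsion E p) (k : K) :
    components E (baseTorsion P + thetaTorsion E p k) = (P, k) :=
  ((existsUnique_base_add_theta E _).choose_spec.2 (P, k) rfl).symm

theorem thetaTorsion_zero {p : ℕ} [CharP K p] : thetaTorsion E p 0 = 0 := rfl

theorem baseTorsion_zero {p : ℕ} : baseTorsion (0 : BaseTorsion E p) = 0 := rfl

theorem components_base {p : ℕ} [CharP K p] (P : BaseTorsion E p) :
    components E (baseTorsion P) = (P, 0) := by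
  rw [← components_base_add_theta P 0, thetaTorsion_zero, add_zero]

theorem components_theta {p : ℕ} [CharP K p] (k : K) :
    components E (thetaTorsion E p k) = (0, k) := by
  rw [← components_base_add_theta 0 k, baseTorsion_zero, zero_add]

theorem components_add {p : ℕ} [CharP K p] (P Q : DualTorsion E p) :
    components E (P + Q) = components E P + components E Q := by
  refine Eq.trans ?_ (components_base_add_theta (components E P + components E Q).1
    (components E P + components E Q).2)
  congr 1
  apply Subtype.ext
  rw [coe_baseTorsion_add_thetaTorsion, AddSubgroup.coe_add]
  conv_lhs => rw [← base_add_theta_components P, ← base_add_theta_components Q]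
  rw [coe_baseTorsion_add_thetaTorsion, coe_baseTorsion_add_thetaTorsion,
    DualPoint.translate_add_translate]
  rfl

/-- The pairing on `Ẽ[p]` that sends `(P + 𝒪ⱼ, Q + 𝒪ₖ)` to `1 + (k c(P) - j c(Q))ε`. -/
noncomputable def pairingOf {p : ℕ} [Fact p.Prime] [CharP K p] (c : BaseTorsion E p → K)
    (P Q : DualTorsion E p) : rootsOfUnity p K[ε] :=
  oneAddEps p ((components E Q).2 * c (components E P).1 -
    (components E P).2 * c (components E Q).1)

theorem isWeilExtension_pairingOf {p : ℕ} [Fact p.Prime] [CharP K p] {c : BaseTorsion E p → K}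
    (hc : ∀ P Q, c (P + Q) = c P + c Q) {e : BaseTorsion E p → K → K[ε]}
    (he : ∀ P k, e P k = 1 + inr (k * c P)) : IsWeilExtension e (pairingOf c) := by
  have hc0 : c 0 = 0 := by simpa using hc 0 0
  refine ⟨fun P k => ?_, fun P Q => ?_, fun j k => ?_, fun P P' Q => ?_, fun P Q Q' => ?_,
    fun P Q => ?_⟩
  · simp [pairingOf, components_base, components_theta, he, coe_oneAddEps]
  · simp [pairingOf, components_base, oneAddEps_eq_one_iff]
  · simp [pairingOf, components_theta, oneAddEps_eq_one_iff, hc0]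
  · rw [pairingOf, pairingOf, pairingOf, ← oneAddEps_add, components_add, Prod.fst_add,
      Prod.snd_add, hc]
    congr 1; ring
  · rw [pairingOf, pairingOf, pairingOf, ← oneAddEps_add, components_add, Prod.fst_add,
      Prod.snd_add, hc]
    congr 1; ring
  · rw [eq_inv_iff_mul_eq_one, pairingOf, pairingOf, ← oneAddEps_add, oneAddEps_eq_one_iff]
    ring

/-- A pairing on `Ẽ[p] = E[p] ⊕ Θ` as in `IsWeilExtension` is determined by its values on
`E[p] × Θ`. -/
theorem IsWeilExtension.unique {p : ℕ} [CharP K p] {e : BaseTorsion E p → K → K[ε]}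
    {ep ep' : DualTorsion E p → DualTorsion E p → rootsOfUnity p K[ε]}
    (h : IsWeilExtension e ep) (h' : IsWeilExtension e ep') : ep' = ep := by
  funext P Q
  have hbt : ∀ P k, ep' (baseTorsion P) (thetaTorsion E p k) =
      ep (baseTorsion P) (thetaTorsion E p k) := fun P k =>
    rootsOfUnity_ext (by rw [h.extends_e, h'.extends_e])
  rw [← base_add_theta_components P, ← base_add_theta_components Q]
  simp only [h.add_left, h.add_right, h'.add_left, h'.add_right, h.base_base, h'.base_base,
    h.theta_theta, h'.theta_theta, hbt]
  rw [h.antisymm (thetaTorsion E p _), h'.antisymm (thetaTorsion E p _), hbt]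

theorem pairingOf_nondegenerate {p : ℕ} [Fact p.Prime] [CharP K p] {c : BaseTorsion E p → K}
    (hc0 : c 0 = 0) (hc : ∀ P, P ≠ 0 → c P ≠ 0) {R : BaseTorsion E p} (hR : R ≠ 0)
    {Q : DualTorsion E p} (hQ : ∀ P, pairingOf c P Q = 1) : Q = 0 := by
  have h₁ := hQ (baseTorsion R)
  have h₂ := hQ (thetaTorsion E p 1)
  rw [pairingOf, oneAddEps_eq_one_iff, components_base, zero_mul, sub_zero,
    mul_eq_zero_iff_right (hc R hR)] at h₁
  rw [pairingOf, oneAddEps_eq_one_iff, components_theta, hc0, mul_zero, zero_sub, one_mul,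
    neg_eq_zero] at h₂
  rw [← base_add_theta_components Q, h₁, not_not.1 (mt (hc _) (not_not.2 h₂)), thetaTorsion_zero,
    baseTorsion_zero, add_zero]

end Extension

end DualCurve

theorem theorem2 {K : Type*} [Field K] [IsAlgClosed K] [DecidableEq K] (p : ℕ) [Fact p.Prime]
    [CharP K p] (hp2 : p ≠ 2) (hp3 : p ≠ 3)
    (E : WeierstrassCurve K) [E.IsShortNF] [E.IsElliptic]
    (R : E.toAffine.Point) (hR : p • R = 0) (hR2 : 2 • R ≠ 0)
    (T : E.toAffine.Point) (hT : T ≠ 0) (hT2 : 2 • T = 0)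
    (C : List (ℕ × ℕ)) (hC : DualCurve.IsAdditionChainDecomposition p C) :
    (∀ P : DualCurve.DualTorsion E p, ∃! Q : DualCurve.BaseTorsion E p × K,
      P = DualCurve.baseTorsion Q.1 + DualCurve.thetaTorsion E p Q.2) ∧
    ∃ ep : DualCurve.DualTorsion E p → DualCurve.DualTorsion E p → rootsOfUnity p K[ε],
      DualCurve.IsWeilExtension (DualCurve.millerPairing C R T) ep ∧
      (∀ ep', DualCurve.IsWeilExtension (DualCurve.millerPairing C R T) ep' → ep' = ep) ∧
      (∀ Q, (∀ P, ep P Q = 1) → Q = 0) ∧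
      (∀ P, (∀ Q, ep P Q = 1) → P = 0) := by
  obtain ⟨S, -, hD⟩ := id hC
  have htors : ∀ P : DualCurve.BaseTorsion E p, p • P.1 = 0 := fun P =>
    AddSubgroup.torsionBy.nsmul_iff.1 P.2
  let c : DualCurve.BaseTorsion E p → K := fun P => -DualCurve.slopeSum C P.1
  have hc : ∀ P Q, c (P + Q) = c P + c Q := fun P Q => by
    simp only [c, AddSubgroup.coe_add, DualCurve.slopeSum_add hD (htors P) (htors Q), neg_add]
  have hc0 : c 0 = 0 := by simpa using hc 0 0
  have hcne : ∀ P, P ≠ 0 → c P ≠ 0 := fun P hP =>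
    neg_ne_zero.2 (DualCurve.slopeSum_ne_zero hp2 hD (htors P) (by simpa using hP))
  have hW : DualCurve.IsWeilExtension (DualCurve.millerPairing C R T) (DualCurve.pairingOf c) :=
    DualCurve.isWeilExtension_pairingOf hc fun P k => by
      rw [DualCurve.millerPairing_eq hp2 hR hT hT2 hC, neg_mul, ← mul_neg]
  let R' : DualCurve.BaseTorsion E p := ⟨R, AddSubgroup.torsionBy.nsmul_iff.2 hR⟩
  have hR' : R' ≠ 0 := fun h => hR2 (by rw [show R = 0 from congrArg Subtype.val h, smul_zero])
  refine ⟨DualCurve.existsUnique_base_add_theta E, DualCurve.pairingOf c, hW,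
    fun ep' h' => hW.unique h', fun Q hQ => ?_, fun P hP => ?_⟩
  · exact DualCurve.pairingOf_nondegenerate hc0 hcne hR' hQ
  · exact DualCurve.pairingOf_nondegenerate hc0 hcne hR' fun Q => by
      rw [hW.antisymm, hP, inv_one]
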